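/- Let $n>1$ be an integer and let $\mathbb{R}^{2n-1}$ have coordinates $(x,y,z)$ with $x=(x_1,\dots,x_{n-1})\in\mathbb{R}^{n-1}$, $y=(y_1,\dots,y_{n-1})\in\mathbb{R}^{n-1}$, $z\in\mathbb{R}$, the Euclidean norm $|\cdot|$, and the standard contact structure $\xi_0=\ker\alpha_0$, where $\alpha_0=dz+\sum_{i=1}^{n-1}x_i\,dy_i$. Then every continuous map $f_0\colon\mathbb{R}\to\mathbb{R}^{2n-1}$ can be approximated in the fine $\mathcal{C}^0$ topology by real-analytic injective $\xi_0$-Legendrian immersions; that is, for every continuous function $\epsilon\colon\mathbb{R}\to(0,+\infty)$ there is an injective real-analytic map $f\colon\mathbb{R}\to\mathbb{R}^{2n-1}$ such that for all $t\in\mathbb{R}$ we have $\dot f(t)\neq 0$, $\dot f(t)\in\xi_0$ at $f(t)$ (i.e. $(\alpha_0)_{f(t)}(\dot f(t))=0$), and $|f(t)-f_0(t)|<\epsilon(t)$. -/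

import Mathlib

open scoped ContDiff

noncomputable section

/-- The Euclidean space `ℝ^{2m+1}` (with its Euclidean norm), whose coordinates are indexed as
`(x, y, z) = (x₁, …, x_m, y₁, …, y_m, z)`. -/
abbrev ContactSpace (m : ℕ) : Type :=
  EuclideanSpace ℝ (Fin m ⊕ Fin m ⊕ Unit)

namespace ContactSpace

variable {m : ℕ}

/-- The index of the coordinate `x_i`. -/
abbrev xIdx (i : Fin m) : Fin m ⊕ Fin m ⊕ Unit := Sum.inl i

/-- The index of the coordinate `y_i`. -/
abbrev yIdx (i : Fin m) : Fin m ⊕ Fin m ⊕ Unit := Sum.inr (Sum.inl i)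

/-- The index of the coordinate `z`. -/
abbrev zIdx : Fin m ⊕ Fin m ⊕ Unit := Sum.inr (Sum.inr ())

/-- The standard contact form `α₀ = dz + ∑ i, x_i dy_i` on `ℝ^{2m+1}`. -/
def contactForm (p : ContactSpace m) : ContactSpace m →L[ℝ] ℝ :=
  EuclideanSpace.proj zIdx + ∑ i : Fin m, p (xIdx i) • EuclideanSpace.proj (yIdx i)

/-- The standard contact structure `ξ₀ = ker α₀`, a hyperplane at every point. -/
def contactStructure (p : ContactSpace m) : Submodule ℝ (ContactSpace m) :=
  LinearMap.ker (contactForm p : ContactSpace m →ₗ[ℝ] ℝ)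

/-- A `ξ₀`-Legendrian immersion of the real line: a smooth curve with nowhere vanishing
velocity that is everywhere tangent to the contact structure. (Curves are called Legendrian
irrespectively of `m`.) -/
structure IsLegendrianImmersion (f : ℝ → ContactSpace m) : Prop where
  smooth : ContDiff ℝ ∞ f
  deriv_ne_zero : ∀ t, deriv f t ≠ 0
  deriv_mem : ∀ t, deriv f t ∈ contactStructure (f t)

end ContactSpace

/-- The basic neighbourhood of a continuous map `f₀ : ℝ → E` in the fine `C⁰` topology that is
determined by a function `ε`. These sets, for all positive continuous `ε`, form a basis of
neighbourhoods of `f₀`. -/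
def fineNhd {E : Type*} [NormedAddCommGroup E] (f₀ : C(ℝ, E)) (ε : ℝ → ℝ) : Set C(ℝ, E) :=
  {f | ∀ t, ‖f t - f₀ t‖ < ε t}

end

open Filter Topology

/-! In dimension three a Legendrian curve is recovered from its (y, z)-projection by x = -z'/y'. Add
to (Y, Z) a small, very fast oscillation (A cos Φ, -B cos Φ) with B = X A. It dominates the
velocity, so -z'/y' is close to B/A = X. Further small terms make y' and z' exactly divisible by sin
Φ, so the quotient is analytic across the critical points of y, which are nondegenerate
(`exists_legendrian_approx`). In higher dimension only one triple (x_i, y_i, z) is treated this way.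
The other pairs are approximated freely, and a primitive of their contribution to ∑ x_i dy_i is
subtracted from z.

For injectivity, replace z by z + a S₁ + b S₂ and x by x + a R₁ + b R₂ with S_j' = -R_j y', which
preserves tangency. The S_j are built so that (S₁, S₂) separates points
(`exists_separating_perturbations`). Along a branch s = σ(t) of y(s) = y(t) on which the remaining
coordinates agree, the Legendrian equation turns a double point into a double zero of the difference
of the z-values. Double zeros correspond to critical values of an analytic function, which are
countable. Hence almost every (a, b) avoids them, and a Lindelöf argument globalizes this
(`generic_injective`).

Fine control at infinity comes from analytic functions growing as fast as desired
(`exists_analytic_majorant`) and from Carleman approximation (`exists_analytic_approx`). -/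

/-! ### Analytic majorants -/

theorem summable_pow_of_diverging_exponent (R : ℝ) (hR : 0 ≤ R) {e : ℕ → ℕ} (he : ∀ k, k ≤ e k) :
    Summable fun k : ℕ ↦ (R / (k + 1)) ^ e k := by
  obtain ⟨K, hK⟩ := exists_nat_ge (2 * R)
  rw [← summable_nat_add_iff K]
  refine Summable.of_nonneg_of_le (fun k ↦ by positivity) (fun k ↦ ?_)
    (summable_geometric_of_lt_one (r := 1 / 2) (by norm_num) (by norm_num))
  have h1 : R / ((k + K : ℕ) + 1) ≤ 1 / 2 := by
    rw [div_le_div_iff₀ (by positivity) (by norm_num)]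
    push_cast
    have : (0 : ℝ) ≤ k := by positivity
    linarith
  calc (R / ((k + K : ℕ) + 1)) ^ e (k + K) ≤ (1 / 2) ^ e (k + K) :=
        pow_le_pow_left₀ (by positivity) h1 _
    _ ≤ (1 / 2) ^ k := pow_le_pow_of_le_one (by norm_num) (by norm_num)
        ((Nat.le_add_right k K).trans (he _))

/-- Every continuous function is majorized by a radially increasing analytic function. -/
theorem exists_analytic_majorant {M : ℝ → ℝ} (hM : Continuous M) :
    ∃ E : ℝ → ℝ, (∀ t, AnalyticAt ℝ E t) ∧ (∀ t, 1 ≤ E t) ∧ (∀ t, M t ≤ E t) ∧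
      ∀ s t, |s| ≤ |t| → E s ≤ E t := by
  have hb : ∀ R : ℝ, ∃ C : ℝ, ∀ t, t ^ 2 ≤ R → M t ≤ C := by
    intro R
    obtain ⟨C, hC⟩ := (isCompact_closedBall (0 : ℝ) (Real.sqrt R)).exists_bound_of_continuousOn
      hM.continuousOn
    refine ⟨C, fun t ht ↦ (le_abs_self _).trans (hC t ?_)⟩
    simpa using Real.abs_le_sqrt ht
  choose B hB using hb
  -- The bound k ≤ e gives convergence everywhere. The other bound is for Bernoulli: where k + 2 ≤
  -- t² ≤ k + 3 the base is at least 1 + 1/(k + 1), so the k-th term alone exceeds B (k + 3).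
  have hn : ∀ k : ℕ, ∃ e : ℕ, k ≤ e ∧ (k + 1) * B (k + 3) ≤ e := by
    intro k
    obtain ⟨e, he⟩ := exists_nat_ge ((k + 1) * B (k + 3))
    exact ⟨max k e, le_max_left _ _, he.trans (by exact_mod_cast le_max_right _ _)⟩
  choose e he heB using hn
  set C := max 1 (B 2)
  have hs : ∀ t : ℝ, Summable fun k : ℕ ↦ (t ^ 2 / (k + 1)) ^ e k := fun t ↦
    summable_pow_of_diverging_exponent _ (sq_nonneg t) he
  have hpos : ∀ (t : ℝ) (k : ℕ), 0 ≤ (t ^ 2 / (k + 1)) ^ e k := fun t k ↦ by positivity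
  refine ⟨fun t ↦ C + ∑' k : ℕ, (t ^ 2 / (k + 1)) ^ e k, fun t ↦ ?_, fun t ↦ ?_, fun t ↦ ?_,
    fun s t hst ↦ ?_⟩
  · have hd : Differentiable ℂ fun z : ℂ ↦ ∑' k : ℕ, (z ^ 2 / (k + 1)) ^ e k := by
      intro z
      have hz : z ∈ Metric.ball (0 : ℂ) (‖z‖ + 1) := by simp
      refine (Complex.differentiableOn_tsum_of_summable_norm (U := Metric.ball (0 : ℂ) (‖z‖ + 1))
        (summable_pow_of_diverging_exponent ((‖z‖ + 1) ^ 2) (by positivity) he) (fun k ↦ ?_)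
        Metric.isOpen_ball fun k w hw ↦ ?_).differentiableAt (Metric.isOpen_ball.mem_nhds hz)
      · fun_prop
      · have hk : ‖(k : ℂ) + 1‖ = k + 1 := by
          rw [← Nat.cast_succ, Complex.norm_natCast]; push_cast; rfl
        rw [norm_pow, norm_div, norm_pow, hk]
        have : ‖w‖ ≤ ‖z‖ + 1 := (mem_ball_zero_iff.1 hw).le
        gcongr
    have : (fun t : ℝ ↦ C + ∑' k : ℕ, (t ^ 2 / (k + 1)) ^ e k) =
        fun t : ℝ ↦ C + (∑' k : ℕ, ((t : ℂ) ^ 2 / (k + 1)) ^ e k).re := by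
      funext t
      congr 1
      rw [← Complex.ofReal_re (∑' k : ℕ, (t ^ 2 / (k + 1)) ^ e k), Complex.ofReal_tsum]
      push_cast
      rfl
    rw [this]
    exact analyticAt_const.add (hd.analyticAt (t : ℂ)).re_ofReal
  · have : 0 ≤ ∑' k : ℕ, (t ^ 2 / (k + 1)) ^ e k := tsum_nonneg (hpos t)
    have := le_max_left 1 (B 2)
    simp only
    linarith
  · simp only
    by_cases h2 : t ^ 2 ≤ 2
    · have : 0 ≤ ∑' k : ℕ, (t ^ 2 / (k + 1)) ^ e k := tsum_nonneg (hpos t)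
      have := le_max_right 1 (B 2)
      have := hB 2 t h2
      linarith
    · push Not at h2
      obtain ⟨k, hk1, hk2⟩ : ∃ k : ℕ, (k : ℝ) + 2 ≤ t ^ 2 ∧ t ^ 2 ≤ k + 3 := by
        refine ⟨⌊t ^ 2 - 2⌋₊, ?_, ?_⟩
        · have := Nat.floor_le (show 0 ≤ t ^ 2 - 2 by linarith); linarith
        · have := Nat.lt_floor_add_one (t ^ 2 - 2); linarith
      have h3 := (hs t).le_tsum k fun j _ ↦ hpos t j
      have h4 : 1 + (1 : ℝ) / (k + 1) ≤ t ^ 2 / (k + 1) := by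
        rw [le_div_iff₀ (by positivity), add_mul, div_mul_cancel₀ _ (by positivity)]; linarith
      have h5 : B (k + 3) ≤ (t ^ 2 / (k + 1)) ^ e k := by
        have hbern : 1 + (e k : ℝ) * (1 / (k + 1)) ≤ (1 + 1 / ((k : ℝ) + 1)) ^ e k :=
          one_add_mul_le_pow (by have : (0 : ℝ) ≤ 1 / (k + 1) := by positivity
                                 linarith) _
        have h6 : B (k + 3) ≤ e k * (1 / ((k : ℝ) + 1)) := by
          rw [mul_one_div, le_div_iff₀ (by positivity), mul_comm]; exact heB k
        have h7 := pow_le_pow_left₀ (by positivity) h4 (e k)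
        linarith
      have := hB _ t hk2
      have := le_max_left 1 (B 2)
      linarith
  · have h2 : s ^ 2 ≤ t ^ 2 := sq_le_sq.2 hst
    have : ∑' k : ℕ, (s ^ 2 / (k + 1)) ^ e k ≤ ∑' k : ℕ, (t ^ 2 / (k + 1)) ^ e k :=
      (hs s).tsum_le_tsum (fun k ↦ by gcongr) (hs t)
    simp only
    linarith

/-! ### Primitives of analytic functions -/

/-- A real-analytic function is locally the real part of a holomorphic function. -/
theorem AnalyticAt.exists_complexification {f : ℝ → ℝ} {x : ℝ} (hf : AnalyticAt ℝ f x) :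
    ∃ g : ℂ → ℂ, ∃ r > 0, DifferentiableOn ℂ g (Metric.ball 0 r) ∧
      ∀ h : ℝ, |h| < r → f (x + h) = (g h).re := by
  obtain ⟨p, R, hp⟩ := hf
  obtain ⟨r, hr0, hrR⟩ := ENNReal.lt_iff_exists_nnreal_btwn.1 hp.r_pos
  have hr0' : 0 < r := by exact_mod_cast hr0
  have hsum : Summable fun n ↦ ‖p n‖ * (r : ℝ) ^ n :=
    p.summable_norm_mul_pow (hrR.trans_le hp.r_le)
  have hc : ∀ n, ‖p n‖ = |p.coeff n| := fun n ↦ by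
    rw [← Real.norm_eq_abs, FormalMultilinearSeries.norm_apply_eq_norm_coef]
  refine ⟨fun z ↦ ∑' n, (p.coeff n : ℂ) * z ^ n, r, by exact_mod_cast hr0', ?_, fun h hh ↦ ?_⟩
  · refine Complex.differentiableOn_tsum_of_summable_norm hsum (fun n ↦ by fun_prop)
      Metric.isOpen_ball fun n w hw ↦ ?_
    rw [norm_mul, norm_pow, Complex.norm_real, Real.norm_eq_abs, hc]
    have : ‖w‖ ≤ r := (mem_ball_zero_iff.1 hw).le
    gcongr
  · have h1 := hp.hasSum (y := h) (by
      refine lt_trans ?_ hrR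
      rw [edist_zero_right, ← ofReal_norm, Real.norm_eq_abs]
      rw [ENNReal.ofReal_lt_coe_iff (abs_nonneg h)]
      exact hh)
    have h2 : f (x + h) = ∑' n, p.coeff n * h ^ n := by
      rw [← h1.tsum_eq]
      congr 1
      funext n
      rw [FormalMultilinearSeries.apply_eq_pow_smul_coeff, smul_eq_mul, mul_comm]
    rw [h2, ← Complex.ofReal_re (∑' n, p.coeff n * h ^ n), Complex.ofReal_tsum]
    push_cast
    rfl

/-- A function whose derivative is analytic is itself analytic. -/
theorem analyticAt_of_hasDerivAt {F f : ℝ → ℝ} (hf : ∀ t, AnalyticAt ℝ f t)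
    (hF : ∀ t, HasDerivAt F (f t) t) (x : ℝ) : AnalyticAt ℝ F x := by
  obtain ⟨g, r, hr, hg, hfg⟩ := (hf x).exists_complexification
  -- A holomorphic primitive exists on the disc, and F differs from its real part by a constant.
  obtain ⟨G, hG⟩ := hg.isExactOn_ball
  have hGd : DifferentiableOn ℂ G (Metric.ball 0 r) := fun z hz ↦
    (hG z hz).differentiableAt.differentiableWithinAt
  have hGa : AnalyticAt ℂ G ((0 : ℝ) : ℂ) :=
    hGd.analyticAt (Metric.isOpen_ball.mem_nhds (by simpa using hr))
  have hconst : ∀ h ∈ Metric.ball (0 : ℝ) r,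
      F (x + h) - (G h).re = F (x + 0) - (G (0 : ℝ)).re := by
    intro h hh
    refine Metric.isOpen_ball.is_const_of_deriv_eq_zero (𝕜 := ℝ)
      (f := fun h : ℝ ↦ F (x + h) - (G h).re)
      (convex_ball (0 : ℝ) r).isPreconnected (fun y hy ↦ ?_) (fun y hy ↦ ?_) hh (by simpa using hr)
    all_goals
      have hy' : |y| < r := by simpa using hy
      have h1 : HasDerivAt (fun h : ℝ ↦ F (x + h) - (G h).re) (f (x + y) - (g y).re) y :=
        ((hF (x + y)).comp_const_add x y).sub (hG y (by simpa using hy')).real_of_complex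
    · exact h1.differentiableAt.differentiableWithinAt
    · rw [h1.deriv, hfg y hy', sub_self]; rfl
  have h1 : AnalyticAt ℝ (fun h : ℝ ↦ (G h).re + (F (x + 0) - (G (0 : ℝ)).re)) 0 :=
    hGa.re_ofReal.add analyticAt_const
  have h2 : AnalyticAt ℝ (fun h : ℝ ↦ F (x + h)) 0 := by
    refine h1.congr ?_
    filter_upwards [Metric.ball_mem_nhds (0 : ℝ) hr] with h hh
    rw [← hconst h hh]; ring
  have h3 : AnalyticAt ℝ (fun t : ℝ ↦ t - x) x := by fun_prop
  have h4 : AnalyticAt ℝ ((fun h : ℝ ↦ F (x + h)) ∘ fun t : ℝ ↦ t - x) x :=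
    AnalyticAt.comp (by simpa using h2) h3
  refine h4.congr (.of_forall fun t ↦ ?_)
  simp

theorem exists_analytic_primitive {f : ℝ → ℝ} (hf : ∀ t, AnalyticAt ℝ f t) :
    ∃ F : ℝ → ℝ, (∀ t, AnalyticAt ℝ F t) ∧ ∀ t, HasDerivAt F (f t) t := by
  have hc : Continuous f := continuous_iff_continuousAt.2 fun t ↦ (hf t).continuousAt
  have hF : ∀ t, HasDerivAt (fun t ↦ ∫ s in (0 : ℝ)..t, f s) (f t) t := fun t ↦
    intervalIntegral.integral_hasDerivAt_right (hc.intervalIntegrable _ _)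
      (hc.stronglyMeasurableAtFilter _ _) hc.continuousAt
  exact ⟨_, analyticAt_of_hasDerivAt hf hF, hF⟩

/-! ### Gaussian regularization and Carleman approximation -/

open MeasureTheory ProbabilityTheory in
theorem integrable_affine_mul_exp_gaussianReal (C a : ℝ) :
    Integrable (fun s ↦ (C + C * |s|) * Real.exp (a * s)) (gaussianReal 0 1) := by
  have h : ∀ b, Integrable (fun s ↦ Real.exp (b * s)) (gaussianReal 0 1) :=
    integrable_exp_mul_gaussianReal
  refine (((h a).add ((h (a + 1)).add (h (a - 1)))).const_mul |C|).mono'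
    (by fun_prop) (.of_forall fun s ↦ ?_)
  have h1 : |s| ≤ Real.exp s + Real.exp (-s) := by
    have := Real.add_one_le_exp s
    have := Real.add_one_le_exp (-s)
    have := Real.exp_pos s
    have := Real.exp_pos (-s)
    rw [abs_le]; constructor <;> linarith
  have h2 : Real.exp ((a + 1) * s) = Real.exp s * Real.exp (a * s) := by
    rw [← Real.exp_add]; ring_nf
  have h3 : Real.exp ((a - 1) * s) = Real.exp (-s) * Real.exp (a * s) := by
    rw [← Real.exp_add]; ring_nf
  have h4 : C + C * |s| = C * (1 + |s|) := by ring
  simp only [Pi.add_apply, h2, h3, Real.norm_eq_abs, h4, abs_mul, Real.abs_exp]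
  rw [abs_of_nonneg (by positivity : 0 ≤ 1 + |s|), mul_assoc]
  gcongr
  nlinarith [Real.exp_pos (a * s)]

open MeasureTheory ProbabilityTheory in
-- For a nonnegative weight the integral is the moment generating function of a measure with all
-- exponential moments, hence analytic. A signed w is the difference of the nonnegative weights w +
-- (C + C|s|) and C + C|s|.
theorem analyticAt_integral_mul_exp_gaussianReal {w : ℝ → ℝ} (hw : Continuous w) {C : ℝ}
    (hC : ∀ s, |w s| ≤ C + C * |s|) (a : ℝ) :
    AnalyticAt ℝ (fun a ↦ ∫ s, w s * Real.exp (a * s) ∂gaussianReal 0 1) a := by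
  have key : ∀ v : ℝ → NNReal, Continuous v → (∃ D : ℝ, ∀ s, (v s : ℝ) ≤ D + D * |s|) →
      AnalyticAt ℝ (fun a ↦ ∫ s, (v s : ℝ) * Real.exp (a * s) ∂gaussianReal 0 1) a := by
    rintro v hv ⟨D, hD⟩
    set μ := (gaussianReal 0 1).withDensity fun s ↦ v s
    have hset : integrableExpSet id μ = Set.univ := by
      refine Set.eq_univ_of_forall fun b ↦ ?_
      change Integrable (fun s ↦ Real.exp (b * s)) μ
      rw [integrable_withDensity_iff_integrable_coe_smul hv.measurable]
      refine (integrable_affine_mul_exp_gaussianReal D b).mono' (by fun_prop) (.of_forall fun s ↦ ?_)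
      rw [smul_eq_mul, Real.norm_of_nonneg (by positivity)]
      gcongr
      exact hD s
    have hmgf : (fun a ↦ ∫ s, (v s : ℝ) * Real.exp (a * s) ∂gaussianReal 0 1) = mgf id μ := by
      funext b
      rw [mgf, integral_withDensity_eq_integral_smul hv.measurable]
      rfl
    rw [hmgf]
    exact analyticAt_mgf (by simp [hset])
  have hwi : ∀ b, Integrable (fun s ↦ (w s + (C + C * |s|)) * Real.exp (b * s))
      (gaussianReal 0 1) := fun b ↦ by
    refine (integrable_affine_mul_exp_gaussianReal (2 * C) b).mono' (by fun_prop)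
      (.of_forall fun s ↦ ?_)
    have := abs_le.1 (hC s)
    rw [norm_mul, Real.norm_eq_abs, Real.norm_eq_abs, Real.abs_exp, abs_of_nonneg (by linarith)]
    exact mul_le_mul_of_nonneg_right (by linarith) (Real.exp_pos _).le
  have h1 := key (fun s ↦ (w s + (C + C * |s|)).toNNReal) (by fun_prop) ⟨2 * C, fun s ↦ by
    have := abs_le.1 (hC s)
    rw [Real.coe_toNNReal _ (by linarith)]; linarith⟩
  have h2 := key (fun s ↦ (C + C * |s|).toNNReal) (by fun_prop) ⟨C, fun s ↦ by
    rw [Real.coe_toNNReal _ ((abs_nonneg _).trans (hC s))]⟩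
  refine (h1.sub h2).congr (.of_forall fun b ↦ ?_)
  have e1 : ∀ s, (((w s + (C + C * |s|)).toNNReal : NNReal) : ℝ) = w s + (C + C * |s|) := fun s ↦ by
    have := abs_le.1 (hC s)
    rw [Real.coe_toNNReal _ (by linarith)]
  have e2 : ∀ s, (((C + C * |s|).toNNReal : NNReal) : ℝ) = C + C * |s| := fun s ↦ by
    rw [Real.coe_toNNReal _ ((abs_nonneg _).trans (hC s))]
  simp only [Pi.sub_apply, e1, e2]
  rw [← integral_sub (hwi b) (integrable_affine_mul_exp_gaussianReal C b)]
  congr 1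
  funext s
  ring

open MeasureTheory ProbabilityTheory in
/-- Gaussian regularization of `1`-Lipschitz functions. -/
theorem exists_analytic_near_lipschitz : ∃ C : ℝ, ∀ U : ℝ → ℝ, (∀ a b, |U a - U b| ≤ |a - b|) →
    ∃ H : ℝ → ℝ, (∀ a, AnalyticAt ℝ H a) ∧ ∀ a, |H a - U a| ≤ C := by
  refine ⟨∫ s, |s| ∂gaussianReal 0 1, fun U hU ↦ ?_⟩
  have hUc : Continuous U := by
    refine LipschitzWith.continuous (K := 1) (LipschitzWith.of_dist_le_mul fun a b ↦ ?_)
    simpa [Real.dist_eq] using hU a b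
  have hUb : ∀ s, |U s| ≤ (|U 0| + 1) + (|U 0| + 1) * |s| := fun s ↦ by
    have h1 := hU s 0
    have h2 := abs_sub_abs_le_abs_sub (U s) (U 0)
    rw [sub_zero] at h1
    nlinarith [abs_nonneg (U 0), abs_nonneg s]
  have habs : Integrable (fun s : ℝ ↦ |s|) (gaussianReal 0 1) := by
    refine (integrable_affine_mul_exp_gaussianReal 1 0).mono' (by fun_prop) (.of_forall fun s ↦ ?_)
    simp
  refine ⟨fun a ↦ ∫ s, U s ∂gaussianReal a 1, fun a ↦ ?_, fun a ↦ ?_⟩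
  -- Moving the centre to a multiplies the standard Gaussian density by exp (-a²/2) exp (a s).
  · have h : (fun a ↦ ∫ s, U s ∂gaussianReal a 1) = fun a ↦ Real.exp (-a ^ 2 / 2) *
        ∫ s, U s * Real.exp (a * s) ∂gaussianReal 0 1 := by
      funext b
      rw [integral_gaussianReal_eq_integral_smul (by simp),
        integral_gaussianReal_eq_integral_smul (by simp), ← integral_const_mul]
      congr 1
      funext s
      simp only [gaussianPDFReal, smul_eq_mul, NNReal.coe_one, mul_one, sub_zero]
      have : Real.exp (-(s - b) ^ 2 / 2) =
          Real.exp (-b ^ 2 / 2) * Real.exp (b * s) * Real.exp (-s ^ 2 / 2) := by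
        rw [← Real.exp_add, ← Real.exp_add]; ring_nf
      rw [this]; ring
    rw [h]
    have := analyticAt_integral_mul_exp_gaussianReal hUc hUb a
    fun_prop
  · have hmap : gaussianReal a 1 = (gaussianReal 0 1).map (a + ·) := by
      rw [gaussianReal_map_const_add]; simp
    have hint : Integrable (fun s ↦ U (a + s)) (gaussianReal 0 1) := by
      refine ((integrable_const |U a|).add habs).mono' (by fun_prop) (.of_forall fun s ↦ ?_)
      have h1 := hU (a + s) a
      have h2 := abs_sub_abs_le_abs_sub (U (a + s)) (U a)
      simp only [add_sub_cancel_left] at h1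
      simp only [Real.norm_eq_abs, Pi.add_apply]
      linarith
    have h1 : ∫ s, U s ∂gaussianReal a 1 - U a =
        ∫ s, (U (a + s) - U a) ∂gaussianReal 0 1 := by
      rw [integral_sub hint (integrable_const _), hmap,
        integral_map (by fun_prop) (by fun_prop)]
      simp
    simp only
    rw [h1]
    refine (abs_integral_le_integral_abs).trans (integral_mono (hint.sub (integrable_const _)).abs habs fun s ↦ ?_)
    simpa using hU (a + s) a

/-- **Carleman approximation**: analytic functions are dense among the continuous functions on the
line in the fine topology. -/
theorem exists_analytic_approx {f ε : ℝ → ℝ} (hf : Continuous f) (hε : Continuous ε)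
    (hε0 : ∀ t, 0 < ε t) : ∃ h : ℝ → ℝ, (∀ t, AnalyticAt ℝ h t) ∧ ∀ t, |h t - f t| < ε t := by
  obtain ⟨C, hC⟩ := exists_analytic_near_lipschitz
  obtain ⟨g, hg, hgf, -⟩ := hf.exists_contDiff_approx (ε := fun t ↦ ε t / 2) 1 (by fun_prop)
    (fun t ↦ half_pos (hε0 t))
  -- Regularization costs a uniform error C. Applying it to E g and dividing by E reduces the error
  -- to C / E ≤ ε / 2.
  obtain ⟨E, hEa, hE1, hE, -⟩ := exists_analytic_majorant (M := fun t ↦ 2 * C / ε t)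
    (by have := fun t ↦ (hε0 t).ne'; fun_prop)
  have hEd : ContDiff ℝ 1 E := contDiff_iff_contDiffAt.2 fun t ↦ (hEa t).contDiffAt
  set F : ℝ → ℝ := fun t ↦ E t * g t with hFdef
  have hF : ContDiff ℝ 1 F := hEd.mul hg
  have hFd : ∀ t, HasDerivAt F (deriv F t) t := fun t ↦
    (hF.differentiable (by norm_num) t).hasDerivAt
  -- The time change φ with φ' = E' ≥ |F'| makes F ∘ φ⁻¹ 1-Lipschitz; φ' ≥ 1 makes φ a bijection of
  -- the line.
  obtain ⟨E', hEa', hE1', hE', -⟩ := exists_analytic_majorant (M := fun t ↦ |deriv F t|)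
    (by have := hF.continuous_deriv (by norm_num); fun_prop)
  obtain ⟨φ, hφa, hφ⟩ := exists_analytic_primitive hEa'
  have hφc : Continuous φ := continuous_iff_continuousAt.2 fun t ↦ (hφa t).continuousAt
  have mono_of : ∀ (k k' : ℝ → ℝ), (∀ t, HasDerivAt k (k' t) t) → (∀ t, 0 ≤ k' t) →
      Monotone k := fun k k' hk hk' ↦
    monotone_of_deriv_nonneg (fun t ↦ (hk t).differentiableAt) fun t ↦ (hk t).deriv ▸ hk' t
  have m1 : Monotone fun t ↦ φ t - t := mono_of _ _ (fun t ↦ (hφ t).sub (hasDerivAt_id t))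
    fun t ↦ sub_nonneg.2 (hE1' t)
  have m2 : Monotone fun t ↦ φ t - F t := mono_of _ _ (fun t ↦ (hφ t).sub (hFd t))
    fun t ↦ sub_nonneg.2 ((le_abs_self _).trans (hE' t))
  have m3 : Monotone fun t ↦ φ t + F t := mono_of _ _ (fun t ↦ (hφ t).add (hFd t))
    fun t ↦ by linarith [neg_le_abs (deriv F t), hE' t]
  have hφm : StrictMono φ := fun s t hst ↦ by have := m1 hst.le; simp only at this; linarith
  have hφs : Function.Surjective φ := by
    refine hφc.surjective ?_ ?_
    · refine tendsto_atTop_mono' atTop ?_ (tendsto_atTop_add_const_right atTop (φ 0) tendsto_id)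
      filter_upwards [eventually_ge_atTop 0] with t ht
      have := m1 ht; simp only [id] at this ⊢; linarith
    · refine tendsto_atBot_mono' atBot ?_ (tendsto_atBot_add_const_right atBot (φ 0) tendsto_id)
      filter_upwards [eventually_le_atBot 0] with t ht
      have := m1 ht; simp only [id] at this ⊢; linarith
  have hLip : ∀ s t, |F s - F t| ≤ |φ s - φ t| := by
    have : ∀ s t, s ≤ t → |F s - F t| ≤ |φ s - φ t| := fun s t hst ↦ by
      have h2 := m2 hst
      have h3 := m3 hst
      have h4 := hφm.monotone hst
      simp only at h2 h3
      rw [abs_of_nonpos (sub_nonpos.2 h4), abs_le]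
      constructor <;> linarith
    intro s t
    rcases le_total s t with h | h
    · exact this s t h
    · rw [abs_sub_comm, abs_sub_comm (φ s)]; exact this t s h
  obtain ⟨ψ, hψ⟩ := hφs.hasRightInverse
  obtain ⟨H, hHa, hH⟩ := hC (fun a ↦ F (ψ a)) fun a b ↦ by
    simpa only [hψ a, hψ b] using hLip (ψ a) (ψ b)
  have hψ' : ∀ t, ψ (φ t) = t := fun t ↦ hφm.injective (hψ _)
  refine ⟨fun t ↦ H (φ t) / E t, fun t ↦ ?_, fun t ↦ ?_⟩
  · exact ((hHa _).comp (hφa t)).div (hEa t) (by linarith [hE1 t])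
  · have hE0 : 0 < E t := by linarith [hE1 t]
    have h1 := hH (φ t)
    simp only [hψ', hFdef] at h1
    have h2 : H (φ t) / E t - g t = (H (φ t) - E t * g t) / E t := by field_simp
    have h3 : |H (φ t) / E t - g t| ≤ ε t / 2 := by
      rw [h2, abs_div, abs_of_pos hE0, div_le_iff₀ hE0]
      have h4 := (div_le_iff₀ (hε0 t)).1 (hE t)
      linarith
    have h5 := hgf t
    rw [Real.dist_eq] at h5
    calc |H (φ t) / E t - f t| = |(H (φ t) / E t - g t) + (g t - f t)| := by ring_nf
      _ ≤ _ := abs_add_le _ _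
      _ < ε t := by linarith

/-! ### Analytic functions decaying at a prescribed rate -/

open MeasureTheory Set in
/-- Nonnegative densities below a suitable analytic weight have finite mass, and their distribution
functions converge at both ends as fast as prescribed. -/
theorem exists_weight_distribution {ε : ℝ → ℝ} (hε : Continuous ε) (hε0 : ∀ t, 0 < ε t) :
    ∃ E : ℝ → ℝ, (∀ t, AnalyticAt ℝ E t) ∧ (∀ t, 1 ≤ E t) ∧
      ∀ ρ : ℝ → ℝ, (∀ t, AnalyticAt ℝ ρ t) → (∀ t, 0 ≤ ρ t) → (∀ t, ρ t ≤ 1 / E t) →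
        ∃ m : ℝ → ℝ, ∃ M : ℝ, (∀ t, AnalyticAt ℝ m t) ∧ (∀ t, HasDerivAt m (ρ t) t) ∧
          (∀ t, 0 ≤ m t) ∧ (∀ t, m t ≤ M) ∧ M ≤ 1 ∧ ∀ t, m t * (M - m t) ≤ ε t := by
  obtain ⟨E, hEa, hE1, hE, hEr⟩ := exists_analytic_majorant (M := fun t ↦ 1 / ε t)
    (by have := fun t ↦ (hε0 t).ne'; fun_prop)
  have hE0 : ∀ t, 0 < E t := fun t ↦ by linarith [hE1 t]
  -- Since ∫ 1/(1 + t²) = π ≤ 4, the total mass is at most 1. As E increases radially, the mass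
  -- beyond t, on the side away from 0, is at most 1 / E t ≤ ε t. It bounds one factor of m (M - m),
  -- and the other is at most 1.
  refine ⟨fun t ↦ 4 * E t * (1 + t ^ 2), fun t ↦ ?_, fun t ↦ ?_, fun ρ hρa hρ0 hρ ↦ ?_⟩
  · have := hEa t; fun_prop
  · nlinarith [hE1 t, sq_nonneg t]
  have hρc : Continuous ρ := continuous_iff_continuousAt.2 fun t ↦ (hρa t).continuousAt
  have hρ' : ∀ t, ρ t ≤ (4 * E t)⁻¹ * (1 + t ^ 2)⁻¹ := fun t ↦ by
    simpa [mul_comm] using hρ t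
  have hint : Integrable ρ := by
    refine integrable_inv_one_add_sq.mono' hρc.aestronglyMeasurable (.of_forall fun t ↦ ?_)
    rw [Real.norm_of_nonneg (hρ0 t)]
    refine (hρ' t).trans (mul_le_of_le_one_left (by positivity) (inv_le_one_of_one_le₀ ?_))
    linarith [hE1 t]
  have hpi : Real.pi / 4 ≤ 1 := by linarith [Real.pi_le_four]
  have hbound : ∀ (S : Set ℝ), MeasurableSet S → ∀ c : ℝ, 0 < c → (∀ t ∈ S, c ≤ E t) →
      ∫ t in S, ρ t ≤ 1 / c := fun S hS c hc hcS ↦ by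
    have h1 : ∫ t in S, ρ t ≤ ∫ t in S, (4 * c)⁻¹ * (1 + t ^ 2)⁻¹ := by
      refine setIntegral_mono_on hint.integrableOn
        (integrable_inv_one_add_sq.const_mul _).integrableOn hS fun t ht ↦ (hρ' t).trans ?_
      have := hcS t ht
      gcongr
    have h2 : ∫ t in S, (4 * c)⁻¹ * (1 + t ^ 2)⁻¹ ≤ ∫ t : ℝ, (4 * c)⁻¹ * (1 + t ^ 2)⁻¹ :=
      setIntegral_le_integral (integrable_inv_one_add_sq.const_mul _)
        (.of_forall fun t ↦ by positivity)
    have h3 := h1.trans h2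
    rw [integral_const_mul (4 * c)⁻¹ fun t : ℝ ↦ (1 + t ^ 2)⁻¹, integral_univ_inv_one_add_sq] at h3
    calc _ ≤ (4 * c)⁻¹ * Real.pi := h3
      _ = (Real.pi / 4) * (1 / c) := by field_simp
      _ ≤ 1 / c := mul_le_of_le_one_left (by positivity) hpi
  set m : ℝ → ℝ := fun t ↦ ∫ s in Iic t, ρ s with hm
  set M : ℝ := ∫ s, ρ s with hM
  have hsplit : ∀ t, m t + ∫ s in Ioi t, ρ s = M := fun t ↦
    intervalIntegral.integral_Iic_add_Ioi hint.integrableOn hint.integrableOn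
  have hm0 : ∀ t, 0 ≤ m t := fun t ↦ integral_nonneg hρ0
  have hr0 : ∀ t, 0 ≤ ∫ s in Ioi t, ρ s := fun t ↦ integral_nonneg hρ0
  have hM1 : M ≤ 1 := by
    have := hbound univ MeasurableSet.univ 1 one_pos fun t _ ↦ hE1 t
    simpa using this
  have hmd : ∀ t, HasDerivAt m (ρ t) t := fun t ↦ by
    have h : m = fun t ↦ m 0 + ∫ s in (0 : ℝ)..t, ρ s := by
      funext t
      rw [← intervalIntegral.integral_Iic_sub_Iic hint.integrableOn hint.integrableOn]
      simp [hm]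
    rw [h]
    exact (intervalIntegral.integral_hasDerivAt_right (hρc.intervalIntegrable _ _)
      (hρc.stronglyMeasurableAtFilter _ _) hρc.continuousAt).const_add _
  refine ⟨m, M, analyticAt_of_hasDerivAt hρa hmd, hmd, hm0, fun t ↦ by linarith [hsplit t, hr0 t],
    hM1, fun t ↦ ?_⟩
  have h1 : 1 / E t ≤ ε t := by
    rw [div_le_comm₀ (hE0 t) (hε0 t)]; exact hE t
  have h2 : m t ≤ 1 / E t ∨ M - m t ≤ 1 / E t := by
    rcases le_total 0 t with ht | ht
    · right
      have := hbound (Ioi t) measurableSet_Ioi (E t) (hE0 t) fun s (hs : t < s) ↦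
        hEr t s (by rw [abs_of_nonneg ht]; exact hs.le.trans (le_abs_self s))
      linarith [hsplit t]
    · left
      exact hbound (Iic t) measurableSet_Iic (E t) (hE0 t) fun s (hs : s ≤ t) ↦
        hEr t s (by rw [abs_of_nonpos ht, abs_of_nonpos (hs.trans ht)]; linarith)
  have h3 := hsplit t
  have h4 := hr0 t
  have h5 := hm0 t
  rcases h2 with h | h <;> nlinarith

/-- Small positive analytic functions with small derivative. -/
theorem exists_analytic_pos_small {ε : ℝ → ℝ} (hε : Continuous ε) (hε0 : ∀ t, 0 < ε t) :
    ∃ u : ℝ → ℝ, (∀ t, AnalyticAt ℝ u t) ∧ (∀ t, 0 < u t) ∧ (∀ t, u t ≤ ε t) ∧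
      ∀ t, |deriv u t| ≤ ε t := by
  obtain ⟨E, hEa, hE1, hE⟩ := exists_weight_distribution hε hε0
  obtain ⟨E', hEa', hE1', hE', -⟩ := exists_analytic_majorant (M := fun t ↦ 1 / ε t)
    (by have := fun t ↦ (hε0 t).ne'; fun_prop)
  have hE0 : ∀ t, 0 < E t := fun t ↦ by linarith [hE1 t]
  have hE0' : ∀ t, 0 < E' t := fun t ↦ by linarith [hE1' t]
  -- With u = m (M - m), u' is (M - 2m) times this density; the factor E' controls it.
  obtain ⟨m, M, hma, hmd, hm0, hmM, hM1, hmε⟩ := hE (fun t ↦ 1 / (E t * E' t))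
    (fun t ↦ by
      have := hEa t
      have := hEa' t
      have : E t * E' t ≠ 0 := (mul_pos (hE0 t) (hE0' t)).ne'
      fun_prop (disch := assumption))
    (fun t ↦ by have := hE0 t; have := hE0' t; positivity)
    (fun t ↦ one_div_le_one_div_of_le (hE0 t) (le_mul_of_one_le_right (hE0 t).le (hE1' t)))
  have hmono : StrictMono m := strictMono_of_deriv_pos fun t ↦ by
    rw [(hmd t).deriv]; have := hE0 t; have := hE0' t; positivity
  have hd : ∀ t, HasDerivAt (fun t ↦ m t * (M - m t)) ((M - 2 * m t) * (1 / (E t * E' t))) t :=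
    fun t ↦ ((hmd t).mul ((hmd t).const_sub M)).congr_deriv (by ring)
  refine ⟨fun t ↦ m t * (M - m t), fun t ↦ ?_, fun t ↦ ?_, hmε, fun t ↦ ?_⟩
  · have := hma t; fun_prop
  · have h1 := hmono (show t - 1 < t by linarith)
    have h2 := hmono (show t < t + 1 by linarith)
    exact mul_pos (by linarith [hm0 (t - 1)]) (by linarith [hmM (t + 1)])
  · rw [(hd t).deriv, abs_mul]
    have h1 : |M - 2 * m t| ≤ 1 := by
      rw [abs_le]; constructor <;> linarith [hm0 t, hmM t]
    have h2 : |1 / (E t * E' t)| ≤ ε t := by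
      have := hE0 t
      have := hE0' t
      rw [abs_of_nonneg (by positivity), div_le_comm₀ (by positivity) (hε0 t)]
      exact (hE' t).trans (le_mul_of_one_le_left (hE0' t).le (hE1 t))
    calc _ ≤ 1 * |1 / (E t * E' t)| := by gcongr
      _ ≤ ε t := by rw [one_mul]; exact h2

/-! ### Perturbations separating points -/

/-- For a function `y` with nondegenerate critical points, two small perturbations `S₁, S₂` of the
`z`-coordinate of a Legendrian curve over `y`, with the induced perturbations `R₁, R₂` of its
`x`-coordinate, that separate points and resolve the singularities over critical points of `y`. -/
theorem exists_separating_perturbations {y ε : ℝ → ℝ} (hy : ∀ t, AnalyticAt ℝ y t)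
    (hcrit : ∀ t, deriv y t = 0 → deriv (deriv y) t ≠ 0) (hε : Continuous ε)
    (hε0 : ∀ t, 0 < ε t) :
    ∃ S₁ S₂ R₁ R₂ : ℝ → ℝ,
      ((∀ t, AnalyticAt ℝ S₁ t) ∧ (∀ t, AnalyticAt ℝ S₂ t) ∧ (∀ t, AnalyticAt ℝ R₁ t) ∧
        ∀ t, AnalyticAt ℝ R₂ t) ∧
      ((∀ t, deriv S₁ t = -R₁ t * deriv y t) ∧ ∀ t, deriv S₂ t = -R₂ t * deriv y t) ∧
      ((∀ t, |S₁ t| ≤ ε t) ∧ (∀ t, |S₂ t| ≤ ε t) ∧ (∀ t, |R₁ t| ≤ ε t) ∧ ∀ t, |R₂ t| ≤ ε t) ∧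
      (∀ s t, S₁ s = S₁ t → S₂ s = S₂ t → s = t) ∧
      ∀ t, deriv y t = 0 → deriv R₁ t = 0 → deriv R₂ t ≠ 0 := by
  have hy' : ∀ t, AnalyticAt ℝ (deriv y) t := fun t ↦ (hy t).deriv
  have hyc : Continuous (deriv y) := continuous_iff_continuousAt.2 fun t ↦ (hy' t).continuousAt
  obtain ⟨E, hEa, hE1, hE⟩ := exists_weight_distribution hε hε0
  -- The summand y'² keeps the density y'²/(E E') below 1 / E; the other yields 2|q| ≤ ε, which
  -- bounds R₁ and R₂.
  obtain ⟨E', hEa', hE1', hE', -⟩ :=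
    exists_analytic_majorant (M := fun t ↦ deriv y t ^ 2 + 2 * |deriv y t| / ε t)
    (by have := fun t ↦ (hε0 t).ne'; fun_prop)
  have hE0 : ∀ t, 0 < E t := fun t ↦ by linarith [hE1 t]
  have hE0' : ∀ t, 0 < E' t := fun t ↦ by linarith [hE1' t]
  set D : ℝ → ℝ := fun t ↦ E t * E' t with hD
  have hD0 : ∀ t, 0 < D t := fun t ↦ mul_pos (hE0 t) (hE0' t)
  have hDa : ∀ t, AnalyticAt ℝ D t := fun t ↦ (hEa t).mul (hEa' t)
  set q : ℝ → ℝ := fun t ↦ deriv y t / D t with hq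
  have hqa : ∀ t, AnalyticAt ℝ q t := fun t ↦ (hy' t).div (hDa t) (hD0 t).ne'
  have hqε : ∀ t, 2 * |q t| ≤ ε t := fun t ↦ by
    rw [hq]
    simp only [abs_div, abs_of_pos (hD0 t)]
    rw [← mul_div_assoc, div_le_iff₀ (hD0 t)]
    have h1 := hE' t
    have h2 : 2 * |deriv y t| / ε t ≤ E' t := by nlinarith [sq_nonneg (deriv y t)]
    rw [div_le_iff₀ (hε0 t)] at h2
    have h3 : E' t ≤ D t := le_mul_of_one_le_left (hE0' t).le (hE1 t)
    nlinarith [hε0 t]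
  obtain ⟨m, M, hma, hmd, hm0, hmM, hM1, hmε⟩ := hE (fun t ↦ deriv y t * q t)
    (fun t ↦ (hy' t).mul (hqa t))
    (fun t ↦ by
      have : deriv y t * q t = deriv y t ^ 2 / D t := by simp only [hq]; ring
      rw [this]; have := hD0 t; positivity)
    (fun t ↦ by
      have h1 : deriv y t * q t = (deriv y t ^ 2 / E' t) * (1 / E t) := by
        have := (hE0 t).ne'
        have := (hE0' t).ne'
        simp only [hq, hD]; field_simp
      rw [h1]
      refine mul_le_of_le_one_left (by have := hE0 t; positivity) ?_
      rw [div_le_one (hE0' t)]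
      have : 0 ≤ 2 * |deriv y t| / ε t := by have := hε0 t; positivity
      linarith [hE' t])
  have hqy : ∀ t, 0 ≤ deriv y t * q t := fun t ↦ by
    have : deriv y t * q t = deriv y t ^ 2 / D t := by simp only [hq]; ring
    rw [this]; have := hD0 t; positivity
  have hmono : Monotone m := monotone_of_deriv_nonneg (fun t ↦ (hmd t).differentiableAt)
    fun t ↦ (hmd t).deriv ▸ hqy t
  have hstrict : StrictMono m := by
    refine hmono.strictMono_of_injective fun a b hab ↦ ?_
    by_contra hne
    wlog hlt : a < b generalizing a b
    · exact this b a hab.symm (Ne.symm hne) (lt_of_le_of_ne (not_lt.1 hlt) (Ne.symm hne))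
    have hzero : ∀ t ∈ Set.Ioo a b, deriv y t = 0 := by
      intro t ht
      have hc : m =ᶠ[𝓝 t] fun _ ↦ m a := by
        filter_upwards [Ioo_mem_nhds ht.1 ht.2] with s hs
        exact le_antisymm (hab ▸ hmono hs.2.le) (hmono hs.1.le)
      have h0 := (hmd t).deriv
      rw [hc.deriv_eq, deriv_const] at h0
      rcases mul_eq_zero.1 h0.symm with h | h
      · exact h
      · simpa [hq, (hD0 t).ne'] using h
    have hmid : (a + b) / 2 ∈ Set.Ioo a b := ⟨by linarith, by linarith⟩
    refine hcrit _ (hzero _ hmid) ?_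
    have hc : deriv y =ᶠ[𝓝 ((a + b) / 2)] fun _ ↦ 0 := by
      filter_upwards [Ioo_mem_nhds hmid.1 hmid.2] with s hs using hzero s hs
    rw [hc.deriv_eq, deriv_const]
  have hpos : ∀ t, 0 < m t ∧ 0 < M - m t := fun t ↦ by
    have h1 := hstrict (show t - 1 < t by linarith)
    have h2 := hstrict (show t < t + 1 by linarith)
    exact ⟨by linarith [hm0 (t - 1)], by linarith [hmM (t + 1)]⟩
  have hd₁ : ∀ t, HasDerivAt (fun t ↦ m t * (M - m t))
      (-(-(M - 2 * m t) * q t) * deriv y t) t := fun t ↦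
    ((hmd t).mul ((hmd t).const_sub M)).congr_deriv (by ring)
  have hd₂ : ∀ t, HasDerivAt (fun t ↦ m t * (m t * (M - m t)))
      (-(-(2 * m t * M - 3 * m t ^ 2) * q t) * deriv y t) t := fun t ↦
    ((hmd t).mul (hd₁ t)).congr_deriv (by ring)
  -- The ratio S₂ / S₁ = m is injective. Both derivatives contain m' = y' q, so dividing by y'
  -- leaves analytic R₁ and R₂ with factor q.
  refine ⟨fun t ↦ m t * (M - m t), fun t ↦ m t * (m t * (M - m t)),
    fun t ↦ -(M - 2 * m t) * q t, fun t ↦ -(2 * m t * M - 3 * m t ^ 2) * q t,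
    ⟨fun t ↦ ?_, fun t ↦ ?_, fun t ↦ ?_, fun t ↦ ?_⟩, ⟨fun t ↦ (hd₁ t).deriv, fun t ↦ (hd₂ t).deriv⟩,
    ⟨fun t ↦ ?_, fun t ↦ ?_, fun t ↦ ?_, fun t ↦ ?_⟩, fun s t h1 h2 ↦ ?_, fun t ht h1 h2 ↦ ?_⟩
  iterate 4
    · have := hma t; have := hqa t; fun_prop
  · rw [abs_of_pos (mul_pos (hpos t).1 (hpos t).2)]; exact hmε t
  · rw [abs_of_pos (mul_pos (hpos t).1 (mul_pos (hpos t).1 (hpos t).2))]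
    exact (mul_le_of_le_one_left (mul_pos (hpos t).1 (hpos t).2).le
      ((hmM t).trans hM1)).trans (hmε t)
  · rw [abs_mul, abs_neg]
    have h1 : |M - 2 * m t| ≤ 2 := by
      rw [abs_le]; constructor <;> linarith [hm0 t, hmM t]
    exact (mul_le_mul_of_nonneg_right h1 (abs_nonneg _)).trans (hqε t)
  · rw [abs_mul, abs_neg]
    have h1 : |2 * m t * M - 3 * m t ^ 2| ≤ 2 := by
      rw [abs_le]; constructor <;> nlinarith [hm0 t, hmM t]
    exact (mul_le_mul_of_nonneg_right h1 (abs_nonneg _)).trans (hqε t)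
  · simp only at h1 h2
    rw [h1] at h2
    exact hstrict.injective (mul_right_cancel₀ (mul_pos (hpos t).1 (hpos t).2).ne' h2)
  · have hq0 : q t = 0 := by simp [hq, ht]
    have hqd : HasDerivAt q (deriv (deriv y) t / D t) t := by
      have := (hy' t).differentiableAt.hasDerivAt.div (hDa t).differentiableAt.hasDerivAt (hD0 t).ne'
      refine this.congr_deriv ?_
      have := (hD0 t).ne'
      rw [ht]; field_simp; ring
    have hqd0 : deriv (deriv y) t / D t ≠ 0 := div_ne_zero (hcrit t ht) (hD0 t).ne'
    have hcoef : ∀ c : ℝ → ℝ, DifferentiableAt ℝ c t → deriv (fun t ↦ c t * q t) t = 0 →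
        c t = 0 := fun c hc h ↦ by
      have h' := h ▸ (hc.hasDerivAt.fun_mul hqd).deriv
      rw [hq0] at h'
      simpa [hqd0] using h'.symm
    have hmdiff := (hma t).differentiableAt
    -- At a critical point q = 0 and q' ≠ 0, so both coefficients of q would vanish: M = 2m, and
    -- then 2mM - 3m² = m² > 0, a contradiction.
    have e1 := hcoef (fun t ↦ -(M - 2 * m t)) (by fun_prop) h1
    have e2 := hcoef (fun t ↦ -(2 * m t * M - 3 * m t ^ 2)) (by fun_prop) h2
    have e3 : M = 2 * m t := by linarith
    rw [e3] at e2
    nlinarith [(hpos t).1]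

/-! ### Legendrian approximation in dimension three -/

/-- Slow differential operators `dP = √u P'` and `d²P = √u (√u P')' = u P'' + u' P' / 2`. -/
theorem hasDerivAt_sqrt_mul_deriv {u P : ℝ → ℝ} (hu : ∀ t, AnalyticAt ℝ u t) (hu0 : ∀ t, 0 < u t)
    (hP : ∀ t, AnalyticAt ℝ P t) (t : ℝ) :
    HasDerivAt (fun t ↦ √(u t) * deriv P t)
      ((u t * deriv (deriv P) t + deriv u t * deriv P t / 2) / √(u t)) t := by
  have h1 := ((hu t).differentiableAt.hasDerivAt.sqrt (hu0 t).ne').fun_mul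
    (hP t).deriv.differentiableAt.hasDerivAt
  refine h1.congr_deriv ?_
  have h2 : √(u t) ≠ 0 := (Real.sqrt_pos.2 (hu0 t)).ne'
  field_simp
  rw [Real.sq_sqrt (hu0 t).le]
  ring

/-- Here p, p' stand for P', P''. Smallness comes from u and u' alone, so the oscillation speed can
be chosen after the functions P. -/
theorem abs_slow_derivs_le {u u' p p' ρ η : ℝ} (hu : 0 < u) (hρ : ρ ≤ 1) (hρ0 : 0 < ρ)
    (huρ : u ≤ ρ ^ 2) (hu' : |u'| ≤ ρ ^ 2) (hη : ρ * (|p| + |p'|) ≤ η) :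
    |√u * p| ≤ η ∧ |u * p' + u' * p / 2| ≤ η := by
  have h1 : √u ≤ ρ := Real.sqrt_le_iff.2 ⟨hρ0.le, huρ⟩
  have h2 : ρ ^ 2 ≤ ρ := by nlinarith
  have h3 := abs_nonneg p
  have h4 := abs_nonneg p'
  constructor
  · rw [abs_mul, abs_of_nonneg (Real.sqrt_nonneg u)]
    nlinarith [mul_le_mul_of_nonneg_right h1 h3]
  · have e1 : |u * p'| ≤ ρ * |p'| := by
      rw [abs_mul, abs_of_pos hu]
      exact mul_le_mul_of_nonneg_right (huρ.trans h2) h4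
    have e2 : |u' * p / 2| ≤ ρ * |p| := by
      rw [abs_div, abs_mul, abs_two]
      nlinarith [mul_le_mul_of_nonneg_right (hu'.trans h2) h3, mul_nonneg hρ0.le h3]
    linarith [abs_add_le (u * p') (u' * p / 2)]

/-- Real-analytic Legendrian approximation in dimension three, with nondegenerate critical points
of the `y`-coordinate. -/
theorem exists_legendrian_approx {X Y Z δ : ℝ → ℝ} (hX : ∀ t, AnalyticAt ℝ X t)
    (hY : ∀ t, AnalyticAt ℝ Y t) (hZ : ∀ t, AnalyticAt ℝ Z t) (hδ : Continuous δ)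
    (hδ0 : ∀ t, 0 < δ t) :
    ∃ x y z : ℝ → ℝ,
      ((∀ t, AnalyticAt ℝ x t) ∧ (∀ t, AnalyticAt ℝ y t) ∧ ∀ t, AnalyticAt ℝ z t) ∧
      ((∀ t, |x t - X t| < δ t) ∧ (∀ t, |y t - Y t| < δ t) ∧ ∀ t, |z t - Z t| < δ t) ∧
      (∀ t, deriv z t = -x t * deriv y t) ∧
      ∀ t, deriv y t = 0 → deriv (deriv y) t ≠ 0 := by
  have hcont : ∀ {f : ℝ → ℝ}, (∀ t, AnalyticAt ℝ f t) → Continuous f := fun hf ↦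
    continuous_iff_continuousAt.2 fun t ↦ (hf t).continuousAt
  have hXc := hcont hX
  set δ' : ℝ → ℝ := fun t ↦ min (δ t) 1 with hδ'
  have hδc : Continuous δ' := by fun_prop
  have hδp : ∀ t, 0 < δ' t := fun t ↦ lt_min (hδ0 t) one_pos
  obtain ⟨E, hEa, hE1, hE, -⟩ := exists_analytic_majorant (M := fun t ↦ 8 * (1 + |X t|) / δ' t)
    (by have := fun t ↦ (hδp t).ne'; fun_prop)
  have hE0 : ∀ t, 0 < E t := fun t ↦ by linarith [hE1 t]
  set A : ℝ → ℝ := fun t ↦ 1 / E t with hA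
  have hA0 : ∀ t, 0 < A t := fun t ↦ one_div_pos.2 (hE0 t)
  have hAa : ∀ t, AnalyticAt ℝ A t := fun t ↦ analyticAt_const.div (hEa t) (hE0 t).ne'
  have hAδ : ∀ t, A t * (1 + |X t|) ≤ δ' t / 8 := fun t ↦ by
    have h1 := hE t
    rw [div_le_iff₀ (hδp t)] at h1
    rw [hA]
    simp only
    rw [one_div, inv_mul_le_iff₀ (hE0 t)]
    linarith
  set B : ℝ → ℝ := fun t ↦ X t * A t with hB
  have hBa : ∀ t, AnalyticAt ℝ B t := fun t ↦ (hX t).mul (hAa t)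
  -- With all slow derivatives at most η, D ≥ A - 4η ≥ 3A/4, while the numerator of x - X is at most
  -- 4η(1 + |X|) = A δ'/4. Hence |x - X| ≤ δ'/3.
  set η : ℝ → ℝ := fun t ↦ A t * δ' t / (16 * (1 + |X t|)) with hη
  have hη0 : ∀ t, 0 < η t := fun t ↦ by
    have := hA0 t
    have := hδp t
    have := abs_nonneg (X t)
    positivity
  have hηc : Continuous η := by
    have h1 := hcont hAa
    have h2 : ∀ t, 16 * (1 + |X t|) ≠ 0 := fun t ↦ by positivity
    fun_prop (disch := assumption)
  set κ : (ℝ → ℝ) → ℝ → ℝ := fun P t ↦ |deriv P t| + |deriv (deriv P) t| with hκ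
  have hκ0 : ∀ P t, 0 ≤ κ P t := fun P t ↦ by positivity
  have hκc : ∀ {P : ℝ → ℝ}, (∀ t, AnalyticAt ℝ P t) → Continuous (κ P) := fun {P} hP ↦
    (hcont fun t ↦ (hP t).deriv).abs.add (hcont fun t ↦ (hP t).deriv.deriv).abs
  set K : ℝ → ℝ := fun t ↦ 1 + κ Y t + κ Z t + κ A t + κ B t with hK
  have hK0 : ∀ t, 0 < K t := fun t ↦ by
    simp only [hK]; linarith [hκ0 Y t, hκ0 Z t, hκ0 A t, hκ0 B t]
  set ρ : ℝ → ℝ := fun t ↦ min 1 (η t / K t) with hρ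
  have hρ0 : ∀ t, 0 < ρ t := fun t ↦ lt_min one_pos (div_pos (hη0 t) (hK0 t))
  have hρc : Continuous ρ := by
    have h1 : Continuous K := by
      have := hκc hY
      have := hκc hZ
      have := hκc hAa
      have := hκc hBa
      fun_prop
    exact continuous_const.min (hηc.div h1 fun t ↦ (hK0 t).ne')
  have hρκ : ∀ t k, k ≤ K t → ρ t * k ≤ η t := fun t k hk ↦ by
    calc ρ t * k ≤ ρ t * K t := mul_le_mul_of_nonneg_left hk (hρ0 t).le
      _ ≤ η t / K t * K t := mul_le_mul_of_nonneg_right (min_le_right _ _) (hK0 t).le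
      _ = η t := div_mul_cancel₀ _ (hK0 t).ne'
  obtain ⟨u, hua, hu0, hu, hu'⟩ := exists_analytic_pos_small (ε := fun t ↦ ρ t ^ 2) (by fun_prop)
    (fun t ↦ pow_pos (hρ0 t) 2)
  set v : ℝ → ℝ := fun t ↦ √(u t) with hv
  have hv0 : ∀ t, 0 < v t := fun t ↦ Real.sqrt_pos.2 (hu0 t)
  have hva : ∀ t, AnalyticAt ℝ v t := fun t ↦ by
    have h1 : AnalyticAt ℝ (fun t ↦ Real.exp (Real.log (u t) / 2)) t := by
      have := (hua t).log (hu0 t)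
      fun_prop
    refine h1.congr (.of_forall fun s ↦ ?_)
    simp only [hv]
    rw [Real.sqrt_eq_rpow, Real.rpow_def_of_pos (hu0 s)]
    ring_nf
  obtain ⟨Φ, hΦa, hΦ⟩ := exists_analytic_primitive (f := fun t ↦ 1 / v t)
    fun t ↦ analyticAt_const.div (hva t) (hv0 t).ne'
  set d : (ℝ → ℝ) → ℝ → ℝ := fun P t ↦ v t * deriv P t with hd
  set d₂ : (ℝ → ℝ) → ℝ → ℝ := fun P t ↦ u t * deriv (deriv P) t + deriv u t * deriv P t / 2
    with hd₂
  have hdd : ∀ {P : ℝ → ℝ}, (∀ t, AnalyticAt ℝ P t) → ∀ t, HasDerivAt (d P) (d₂ P t / v t) t :=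
    fun hP t ↦ hasDerivAt_sqrt_mul_deriv hua hu0 hP t
  have hda : ∀ {P : ℝ → ℝ}, (∀ t, AnalyticAt ℝ P t) → ∀ t, AnalyticAt ℝ (d P) t :=
    fun hP t ↦ (hva t).mul (hP t).deriv
  have hd₂a : ∀ {P : ℝ → ℝ}, (∀ t, AnalyticAt ℝ P t) → ∀ t, AnalyticAt ℝ (d₂ P) t :=
    fun {P} hP t ↦ by
      have h1 := (hP t).deriv
      have h2 := (hP t).deriv.deriv
      have h3 := (hua t).deriv
      have h4 := hua t
      simp only [hd₂]
      fun_prop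
  have hsmall : ∀ P t, κ P t ≤ K t → |d P t| ≤ η t ∧ |d₂ P t| ≤ η t := fun P t h ↦
    abs_slow_derivs_le (hu0 t) (min_le_left _ _) (hρ0 t) (hu t) (hu' t) (hρκ t _ h)
  set s : ℝ → ℝ := fun t ↦ Real.sin (Φ t) with hs
  set c : ℝ → ℝ := fun t ↦ Real.cos (Φ t) with hc
  have hsd : ∀ t, HasDerivAt s (c t / v t) t := fun t ↦
    (hΦ t).sin.congr_deriv (by simp only [hc]; ring)
  have hcd : ∀ t, HasDerivAt c (-s t / v t) t := fun t ↦
    (hΦ t).cos.congr_deriv (by simp only [hs]; ring)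
  have hsa : ∀ t, AnalyticAt ℝ s t := fun t ↦ Real.analyticAt_sin.comp (hΦa t)
  have hca : ∀ t, AnalyticAt ℝ c t := fun t ↦ Real.analyticAt_cos.comp (hΦa t)
  have hsc : ∀ t, s t ^ 2 + c t ^ 2 = 1 := fun t ↦ Real.sin_sq_add_cos_sq _
  have hs1 : ∀ t, |s t| ≤ 1 := fun t ↦ Real.abs_sin_le_one _
  have hc1 : ∀ t, |c t| ≤ 1 := fun t ↦ Real.abs_cos_le_one _
  set N : ℝ → ℝ := fun t ↦ 2 * d Z t * s t - d₂ Z t * c t + B t + d₂ B t with hN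
  set D : ℝ → ℝ := fun t ↦ A t + d₂ A t - 2 * d Y t * s t + d₂ Y t * c t with hD
  have hNa : ∀ t, AnalyticAt ℝ N t := fun t ↦ by
    have := hda hZ t
    have := hd₂a hZ t
    have := hd₂a hBa t
    have := hBa t
    have := hsa t
    have := hca t
    simp only [hN]
    fun_prop
  have hDa : ∀ t, AnalyticAt ℝ D t := fun t ↦ by
    have := hda hY t
    have := hd₂a hY t
    have := hd₂a hAa t
    have := hAa t
    have := hsa t
    have := hca t
    simp only [hD]
    fun_prop
  have mul_le : ∀ {a b r : ℝ}, |a| ≤ r → |b| ≤ 1 → |a * b| ≤ r := fun {a b r} ha hb ↦ by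
    rw [abs_mul]; nlinarith [abs_nonneg a, abs_nonneg b]
  have hκY : ∀ t, κ Y t ≤ K t := fun t ↦ by
    simp only [hK]; linarith [hκ0 Y t, hκ0 Z t, hκ0 A t, hκ0 B t]
  have hκZ : ∀ t, κ Z t ≤ K t := fun t ↦ by
    simp only [hK]; linarith [hκ0 Y t, hκ0 Z t, hκ0 A t, hκ0 B t]
  have hκA : ∀ t, κ A t ≤ K t := fun t ↦ by
    simp only [hK]; linarith [hκ0 Y t, hκ0 Z t, hκ0 A t, hκ0 B t]
  have hκB : ∀ t, κ B t ≤ K t := fun t ↦ by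
    simp only [hK]; linarith [hκ0 Y t, hκ0 Z t, hκ0 A t, hκ0 B t]
  have hηA : ∀ t, 16 * (1 + |X t|) * η t = A t * δ' t := fun t ↦ by
    have : 1 + |X t| ≠ 0 := by positivity
    simp only [hη]
    field_simp
  have hηA' : ∀ t, 16 * η t ≤ A t := fun t ↦ by
    have h1 := hηA t
    have h2 : A t * δ' t ≤ A t := mul_le_of_le_one_right (hA0 t).le (min_le_right _ _)
    nlinarith [mul_nonneg (abs_nonneg (X t)) (hη0 t).le]
  have hD0 : ∀ t, 3 / 4 * A t ≤ D t := fun t ↦ by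
    have h1 := abs_le.1 (hsmall A t (hκA t)).2
    have h2 := abs_le.1 (mul_le (hsmall Y t (hκY t)).1 (hs1 t))
    have h3 := abs_le.1 (mul_le (hsmall Y t (hκY t)).2 (hc1 t))
    have h4 := hηA' t
    simp only [hD]
    linarith
  have hDpos : ∀ t, 0 < D t := fun t ↦ by linarith [hD0 t, hA0 t]
  -- The correction -(d Y) s c changes Y' into 2 Y' s² up to a multiple of s, by 1 - c² + s² = 2s².
  -- The term -(d A) s cancels A' c. Thus s divides y' exactly; z' works likewise.
  have hyd : ∀ t, HasDerivAt (fun t ↦ Y t - d Y t * s t * c t + A t * c t - d A t * s t)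
      (s t * (-D t / v t)) t := fun t ↦ by
    have h1 := (((hY t).differentiableAt.hasDerivAt.fun_sub
      (((hdd hY t).fun_mul (hsd t)).fun_mul (hcd t))).fun_add
      ((hAa t).differentiableAt.hasDerivAt.fun_mul (hcd t))).fun_sub ((hdd hAa t).fun_mul (hsd t))
    refine h1.congr_deriv ?_
    have h2 := hsc t
    have h3 := (hv0 t).ne'
    simp only [hD, hd]
    field_simp
    linear_combination (-v t * deriv Y t) * h2
  have hzd : ∀ t, HasDerivAt (fun t ↦ Z t - d Z t * s t * c t - B t * c t + d B t * s t)
      (s t * (N t / v t)) t := fun t ↦ by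
    have h1 := (((hZ t).differentiableAt.hasDerivAt.fun_sub
      (((hdd hZ t).fun_mul (hsd t)).fun_mul (hcd t))).fun_sub
      ((hBa t).differentiableAt.hasDerivAt.fun_mul (hcd t))).fun_add ((hdd hBa t).fun_mul (hsd t))
    refine h1.congr_deriv ?_
    have h2 := hsc t
    have h3 := (hv0 t).ne'
    simp only [hN, hd]
    field_simp
    linear_combination (-v t * deriv Z t) * h2
  have hηδ : ∀ t, 16 * η t ≤ δ' t / 8 := fun t ↦ by
    nlinarith [hηA' t, hAδ t, mul_nonneg (hA0 t).le (abs_nonneg (X t))]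
  have hδδ : ∀ t, δ' t ≤ δ t := fun t ↦ min_le_left _ _
  refine ⟨fun t ↦ N t / D t, fun t ↦ Y t - d Y t * s t * c t + A t * c t - d A t * s t,
    fun t ↦ Z t - d Z t * s t * c t - B t * c t + d B t * s t, ⟨fun t ↦ ?_, fun t ↦ ?_, fun t ↦ ?_⟩,
    ⟨fun t ↦ ?_, fun t ↦ ?_, fun t ↦ ?_⟩, fun t ↦ ?_, fun t ht ↦ ?_⟩
  · exact (hNa t).div (hDa t) (hDpos t).ne'
  · have := hY t
    have := hda hY t
    have := hAa t
    have := hda hAa t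
    have := hsa t
    have := hca t
    fun_prop
  · have := hZ t
    have := hda hZ t
    have := hBa t
    have := hda hBa t
    have := hsa t
    have := hca t
    fun_prop
  · have e : N t / D t - X t = (2 * (d Z t * s t) - d₂ Z t * c t + d₂ B t
        + X t * (2 * (d Y t * s t) - d₂ Y t * c t - d₂ A t)) / D t := by
      rw [eq_div_iff (hDpos t).ne', sub_mul, div_mul_cancel₀ _ (hDpos t).ne']
      simp only [hN, hD, hB]
      ring
    have h1 := abs_le.1 (mul_le (hsmall Z t (hκZ t)).1 (hs1 t))
    have h2 := abs_le.1 (mul_le (hsmall Z t (hκZ t)).2 (hc1 t))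
    have h3 := abs_le.1 (hsmall B t (hκB t)).2
    have h4 := abs_le.1 (mul_le (hsmall Y t (hκY t)).1 (hs1 t))
    have h5 := abs_le.1 (mul_le (hsmall Y t (hκY t)).2 (hc1 t))
    have h6 := abs_le.1 (hsmall A t (hκA t)).2
    have h7 : |2 * (d Z t * s t) - d₂ Z t * c t + d₂ B t| ≤ 4 * η t := by
      rw [abs_le]; constructor <;> linarith
    have h8 : |2 * (d Y t * s t) - d₂ Y t * c t - d₂ A t| ≤ 4 * η t := by
      rw [abs_le]; constructor <;> linarith
    have h9 := abs_add_le (2 * (d Z t * s t) - d₂ Z t * c t + d₂ B t)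
      (X t * (2 * (d Y t * s t) - d₂ Y t * c t - d₂ A t))
    rw [abs_mul] at h9
    have h10 := mul_le_mul_of_nonneg_left h8 (abs_nonneg (X t))
    simp only
    rw [e, abs_div, abs_of_pos (hDpos t), div_lt_iff₀ (hDpos t)]
    have h11 := hηA t
    have h12 := mul_le_mul_of_nonneg_left (hD0 t) (hδp t).le
    have h13 := mul_le_mul_of_nonneg_right (hδδ t) (hDpos t).le
    nlinarith [mul_pos (hA0 t) (hδp t)]
  · have h1 := abs_le.1 (mul_le (mul_le (hsmall Y t (hκY t)).1 (hs1 t)) (hc1 t))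
    have h2 := abs_le.1 (mul_le (le_of_eq (abs_of_pos (hA0 t))) (hc1 t))
    have h3 := abs_le.1 (mul_le (hsmall A t (hκA t)).1 (hs1 t))
    have h4 : A t ≤ δ' t / 8 :=
      (le_mul_of_one_le_right (hA0 t).le (by linarith [abs_nonneg (X t)])).trans (hAδ t)
    rw [abs_lt]
    constructor <;> linarith [hηδ t, hδδ t, hδp t]
  · have h1 := abs_le.1 (mul_le (mul_le (hsmall Z t (hκZ t)).1 (hs1 t)) (hc1 t))
    have h2 : |B t| ≤ δ' t / 8 := by
      simp only [hB]
      rw [abs_mul, abs_of_pos (hA0 t)]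
      nlinarith [hAδ t, hA0 t]
    have h3 := abs_le.1 (mul_le h2 (hc1 t))
    have h4 := abs_le.1 (mul_le (hsmall B t (hκB t)).1 (hs1 t))
    rw [abs_lt]
    constructor <;> linarith [hηδ t, hδδ t, hδp t]
  · rw [(hzd t).deriv, (hyd t).deriv]
    have := (hDpos t).ne'
    have := (hv0 t).ne'
    field_simp
  · have hL : ∀ t, AnalyticAt ℝ (fun t ↦ -D t / v t) t := fun t ↦
      (hDa t).neg.div (hva t) (hv0 t).ne'
    have hL0 : -D t / v t ≠ 0 := div_ne_zero (neg_ne_zero.2 (hDpos t).ne') (hv0 t).ne'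
    rw [(hyd t).deriv] at ht
    have hs0 : s t = 0 := (mul_eq_zero.1 ht).resolve_right hL0
    rw [funext fun t ↦ (hyd t).deriv, ((hsd t).fun_mul (hL t).differentiableAt.hasDerivAt).deriv,
      hs0, zero_mul, add_zero]
    refine mul_ne_zero (div_ne_zero ?_ (hv0 t).ne') hL0
    have := hsc t
    rw [hs0] at this
    intro h
    simp [h] at this

/-! ### Generic parameters and double zeros -/

instance cocountable_countableInterFilter {α : Type*} :
    CountableInterFilter (cocountable : Filter α) :=
  cardinalInterFilter_aleph_one_iff.1 inferInstance

/-- A property of two real parameters holds generically if, for all but countably many values of the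
second one, it holds for all but countably many values of the first one. -/
def Generic (P : ℝ → ℝ → Prop) : Prop :=
  ∀ᶠ b in (cocountable : Filter ℝ), ∀ᶠ a in (cocountable : Filter ℝ), P a b

namespace Generic

theorem mono {P Q : ℝ → ℝ → Prop} (hP : Generic P) (h : ∀ a b, P a b → Q a b) : Generic Q :=
  Eventually.mono hP fun b hb ↦ hb.mono fun a ↦ h a b

theorem and {P Q : ℝ → ℝ → Prop} (hP : Generic P) (hQ : Generic Q) :
    Generic fun a b ↦ P a b ∧ Q a b := by
  filter_upwards [hP, hQ] with b h1 h2 using h1.and h2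

theorem ball_countable {ι : Type*} {S : Set ι} (hS : S.Countable) {P : ι → ℝ → ℝ → Prop}
    (h : ∀ i ∈ S, Generic (P i)) : Generic fun a b ↦ ∀ i ∈ S, P i a b := by
  filter_upwards [(eventually_countable_ball hS).2 h] with b hb
  exact (eventually_countable_ball hS).2 hb

/-- If p ≠ 0, each b excludes a single a; if p = 0, a single b is excluded. -/
theorem line {c p q : ℝ} (h : p = 0 → q ≠ 0) : Generic fun a b ↦ c + a * p + b * q ≠ 0 := by
  by_cases hp : p = 0
  · filter_upwards [eventually_cocardinal_ne (-c / q)] with b hb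
    refine .of_forall fun a h0 ↦ hb ?_
    rw [eq_div_iff (h hp)]
    rw [hp] at h0
    linarith
  · refine .of_forall fun b ↦ ?_
    filter_upwards [eventually_cocardinal_ne (-(c + b * q) / p)] with a ha h0
    refine ha ?_
    rw [eq_div_iff hp]
    linarith

theorem exists_mem_Ioo {P : ℝ → ℝ → Prop} (h : Generic P) {r : ℝ} (hr : 0 < r) :
    ∃ a ∈ Set.Ioo 0 r, ∃ b ∈ Set.Ioo 0 r, P a b := by
  have key : ∀ {Q : ℝ → Prop}, (∀ᶠ a in (cocountable : Filter ℝ), Q a) →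
      ∃ a ∈ Set.Ioo 0 r, Q a := fun {Q} hQ ↦ by
    by_contra! hne
    have h1 : {a | Q a}ᶜ.Countable := mem_cocountable.1 hQ
    exact (Cardinal.Real.Ioo_countable_iff.not.2 (not_le.2 hr)) (h1.mono fun a ha ↦ hne a ha)
  obtain ⟨b, hb, hb'⟩ := key h
  obtain ⟨a, ha, ha'⟩ := key hb'
  exact ⟨a, ha, b, hb, ha'⟩

end Generic

theorem countable_zeros_of_analyticAt {f : ℝ → ℝ} (hf : ∀ t, AnalyticAt ℝ f t)
    (h : ∀ t, ¬∀ᶠ s in 𝓝 t, f s = 0) : {t | f t = 0}.Countable := by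
  refine (HereditarilyLindelofSpace.isLindelof {t | f t = 0}).induction_on (p := Set.Countable)
    (fun s t hst ht ↦ ht.mono hst) (fun S hS h ↦ hS.sUnion h) fun t _ ↦ ?_
  refine ⟨{t}, ?_, Set.countable_singleton t⟩
  have h1 := (hf t).eventually_eq_zero_or_eventually_ne_zero.resolve_left (h t)
  rw [eventually_nhdsWithin_iff] at h1
  rw [mem_nhdsWithin_iff_eventually]
  filter_upwards [h1] with s hs h0
  by_contra hne
  exact hs hne h0

/-- The set of critical values of an analytic function of one variable is countable. -/
theorem countable_critical_values {q : ℝ → ℝ} {U : Set ℝ} (hq : ∀ t ∈ U, AnalyticAt ℝ q t) :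
    (q '' {t ∈ U | deriv q t = 0}).Countable := by
  refine (HereditarilyLindelofSpace.isLindelof {t ∈ U | deriv q t = 0}).induction_on
    (p := fun S ↦ (q '' S).Countable) (fun s t hst ht ↦ ht.mono (Set.image_mono hst))
    (fun S hS h ↦ ?_) fun t ht ↦ ?_
  · rw [Set.sUnion_eq_biUnion, Set.image_iUnion₂]
    exact hS.biUnion h
  -- Locally, either q is constant and contributes one value, or the critical point is isolated.
  rcases (hq t ht.1).deriv.eventually_eq_zero_or_eventually_ne_zero with h | h
  · obtain ⟨r, hr, hball⟩ := Metric.eventually_nhds_iff_ball.1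
      (h.and (hq t ht.1).eventually_analyticAt)
    refine ⟨Metric.ball t r, mem_nhdsWithin_of_mem_nhds (Metric.ball_mem_nhds t hr),
      (Set.countable_singleton (q t)).mono ?_⟩
    rintro _ ⟨s, hs, rfl⟩
    exact Metric.isOpen_ball.is_const_of_deriv_eq_zero (convex_ball t r).isPreconnected
      (fun y hy ↦ (hball y hy).2.differentiableAt.differentiableWithinAt)
      (fun y hy ↦ (hball y hy).1) hs (Metric.mem_ball_self hr)
  · refine ⟨{t}, ?_, by simp⟩
    rw [eventually_nhdsWithin_iff] at h
    rw [mem_nhdsWithin_iff_eventually]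
    filter_upwards [h] with s hs h0
    by_contra hne
    exact hs hne h0.2

/-- A double zero of g + a h at t means that t is a critical point of -g / h with value a. -/
theorem eventually_no_double_zero {g h : ℝ → ℝ} {U : Set ℝ} (hg : ∀ t ∈ U, AnalyticAt ℝ g t)
    (hh : ∀ t ∈ U, AnalyticAt ℝ h t) (h0 : ∀ t ∈ U, h t ≠ 0) :
    ∀ᶠ a in (cocountable : Filter ℝ), ∀ t ∈ U, g t + a * h t = 0 →
      deriv g t + a * deriv h t ≠ 0 := by
  have hq : ∀ t ∈ U, AnalyticAt ℝ (fun t ↦ -g t / h t) t := fun t ht ↦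
    (hg t ht).neg.div (hh t ht) (h0 t ht)
  have hc := countable_critical_values hq
  rw [← compl_compl ((fun t ↦ -g t / h t) '' _), ← mem_cocountable] at hc
  filter_upwards [hc] with a ha t ht e1 e2
  refine ha ⟨t, ⟨ht, ?_⟩, ?_⟩
  · have hd : HasDerivAt (fun t ↦ -g t / h t) ((-deriv g t * h t - -g t * deriv h t) / h t ^ 2) t :=
      (hg t ht).differentiableAt.hasDerivAt.fun_neg.fun_div
        (hh t ht).differentiableAt.hasDerivAt (h0 t ht)
    rw [hd.deriv, div_eq_zero_iff]
    left
    linear_combination (deriv h t) * e1 - (h t) * e2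
  · simp only
    rw [div_eq_iff (h0 t ht)]
    linarith

/-- If h₁ ≠ 0 nearby, vary a with b fixed; if h₁ vanishes identically nearby, vary b. If t₀ is an
isolated zero of h₁, the first argument works off t₀, and at t₀ a generic choice prevents any zero.
-/
theorem exists_nhds_generic_no_double_zero {g h₁ h₂ : ℝ → ℝ} {t₀ : ℝ} (hg : AnalyticAt ℝ g t₀)
    (hh₁ : AnalyticAt ℝ h₁ t₀) (hh₂ : AnalyticAt ℝ h₂ t₀) (h0 : h₁ t₀ = 0 → h₂ t₀ ≠ 0) :
    ∃ V ∈ 𝓝 t₀, Generic fun a b ↦ ∀ t ∈ V, g t + a * h₁ t + b * h₂ t = 0 →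
      deriv g t + a * deriv h₁ t + b * deriv h₂ t ≠ 0 := by
  have han : ∀ᶠ t in 𝓝 t₀, AnalyticAt ℝ g t ∧ AnalyticAt ℝ h₁ t ∧ AnalyticAt ℝ h₂ t :=
    hg.eventually_analyticAt.and (hh₁.eventually_analyticAt.and hh₂.eventually_analyticAt)
  have main : ∀ V : Set ℝ, (∀ t ∈ V, AnalyticAt ℝ g t ∧ AnalyticAt ℝ h₁ t ∧ AnalyticAt ℝ h₂ t) →
      (∀ t ∈ V, h₁ t ≠ 0) → Generic fun a b ↦ ∀ t ∈ V, g t + a * h₁ t + b * h₂ t = 0 →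
      deriv g t + a * deriv h₁ t + b * deriv h₂ t ≠ 0 := by
    intro V hV hV0
    refine .of_forall fun b ↦ ?_
    filter_upwards [eventually_no_double_zero (g := fun t ↦ g t + b * h₂ t)
      (fun t ht ↦ (hV t ht).1.fun_add (analyticAt_const.fun_mul (hV t ht).2.2))
      (fun t ht ↦ (hV t ht).2.1) hV0] with a ha t ht e1 e2
    refine ha t ht (by linarith) ?_
    have hd : HasDerivAt (fun t ↦ g t + b * h₂ t) (deriv g t + b * deriv h₂ t) t :=
      (hV t ht).1.differentiableAt.hasDerivAt.fun_add
        ((hV t ht).2.2.differentiableAt.hasDerivAt.const_mul b)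
    rw [hd.deriv]
    linarith
  by_cases h10 : h₁ t₀ = 0
  · rcases hh₁.eventually_eq_zero_or_eventually_ne_zero with hz | hz
    · have hV : ∀ᶠ t in 𝓝 t₀, (AnalyticAt ℝ g t ∧ AnalyticAt ℝ h₁ t ∧ AnalyticAt ℝ h₂ t) ∧
          (∀ᶠ s in 𝓝 t, h₁ s = 0) ∧ h₂ t ≠ 0 :=
        han.and (hz.eventually_nhds.and (hh₂.continuousAt.eventually_ne (h0 h10)))
      refine ⟨_, hV, ?_⟩
      filter_upwards [eventually_no_double_zero (U := {t | (AnalyticAt ℝ g t ∧ AnalyticAt ℝ h₁ t ∧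
        AnalyticAt ℝ h₂ t) ∧ (∀ᶠ s in 𝓝 t, h₁ s = 0) ∧ h₂ t ≠ 0}) (fun t ht ↦ ht.1.1)
        (fun t ht ↦ ht.1.2.2) (fun t ht ↦ ht.2.2)] with b hb
      refine .of_forall fun a t ht e1 e2 ↦ hb t ht ?_ ?_
      · rw [ht.2.1.self_of_nhds] at e1; linarith
      · have : deriv h₁ t = 0 := by
          rw [EventuallyEq.deriv_eq (f := fun _ ↦ 0) ht.2.1, deriv_const]
        rw [this] at e2; linarith
    · rw [eventually_nhdsWithin_iff] at hz
      have hV := han.and hz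
      refine ⟨_, hV, ?_⟩
      refine ((main {t | ((AnalyticAt ℝ g t ∧ AnalyticAt ℝ h₁ t ∧ AnalyticAt ℝ h₂ t) ∧
        (t ∈ ({t₀}ᶜ : Set ℝ) → h₁ t ≠ 0)) ∧ t ≠ t₀} (fun t ht ↦ ht.1.1)
        (fun t ht ↦ ht.1.2 ht.2)).and (Generic.line (c := g t₀) h0)).mono fun a b hab t ht ↦ ?_
      by_cases htt : t = t₀
      · rw [htt]; exact fun e ↦ absurd e hab.2
      · exact hab.1 t ⟨ht, htt⟩
  · exact ⟨_, han.and (hh₁.continuousAt.eventually_ne h10), main _ (fun t ht ↦ ht.1)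
      fun t ht ↦ ht.2⟩

/-! ### Generic injectivity of Legendrian curves -/

section Legendrian

variable {V : Type*} [NormedAddCommGroup V] [NormedSpace ℝ V]

/-- Near a pair of points of the line with the same value of `y`, the second one regular, a curve tangent to
`dz + x dy + β(u) du` has no double points after a generic perturbation. -/
theorem exists_nhds_generic_ne {x y z S₁ S₂ R₁ R₂ : ℝ → ℝ} {u : ℝ → V} {β : V → V →L[ℝ] ℝ}
    (hy : ∀ t, AnalyticAt ℝ y t) (hz : ∀ t, AnalyticAt ℝ z t) (hu : ∀ t, AnalyticAt ℝ u t)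
    (hS₁ : ∀ t, AnalyticAt ℝ S₁ t) (hS₂ : ∀ t, AnalyticAt ℝ S₂ t)
    (hz' : ∀ t, deriv z t = -x t * deriv y t - β (u t) (deriv u t))
    (hS₁' : ∀ t, deriv S₁ t = -R₁ t * deriv y t) (hS₂' : ∀ t, deriv S₂ t = -R₂ t * deriv y t)
    {t₀ s₀ : ℝ} (hsep : S₁ t₀ = S₁ s₀ → S₂ t₀ ≠ S₂ s₀) (hyeq : y t₀ = y s₀)
    (hs₀ : deriv y s₀ ≠ 0) :
    ∃ N ∈ 𝓝 (t₀, s₀), Generic fun a b ↦ ∀ p ∈ N, y p.1 = y p.2 → u p.1 = u p.2 →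
      x p.1 + a * R₁ p.1 + b * R₂ p.1 = x p.2 + a * R₁ p.2 + b * R₂ p.2 →
      z p.1 + a * S₁ p.1 + b * S₂ p.1 ≠ z p.2 + a * S₁ p.2 + b * S₂ p.2 := by
  set ψ := (hy s₀).hasStrictDerivAt.localInverse _ _ _ hs₀ with hψ
  have hψa : AnalyticAt ℝ ψ (y t₀) := hyeq ▸ (hy s₀).analyticAt_localInverse hs₀
  have hψs : ψ (y s₀) = s₀ := HasStrictFDerivAt.localInverse_apply_image ..
  have hψl : ∀ᶠ s in 𝓝 s₀, ψ (y s) = s := HasStrictDerivAt.eventually_left_inverse ..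
  have hψr : ∀ᶠ w in 𝓝 (y t₀), y (ψ w) = w := hyeq ▸ HasStrictDerivAt.eventually_right_inverse ..
  -- Near (t₀, s₀) the set y(t) = y(s) is the graph s = σ(t), since y is invertible at s₀.
  set σ : ℝ → ℝ := fun t ↦ ψ (y t) with hσ
  have hσa : AnalyticAt ℝ σ t₀ := hψa.comp (hy t₀)
  have hσ0 : σ t₀ = s₀ := by simp only [hσ, hyeq, hψs]
  have hyσ : ∀ᶠ t in 𝓝 t₀, y (σ t) = y t := (hy t₀).continuousAt.eventually hψr
  have hcomp : ∀ {f : ℝ → ℝ}, (∀ t, AnalyticAt ℝ f t) →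
      AnalyticAt ℝ (fun t ↦ f t - f (σ t)) t₀ := fun {f} hf ↦
    (hf t₀).fun_sub ((hf (σ t₀)).comp hσa)
  have huσ : AnalyticAt ℝ (fun t ↦ u t - u (σ t)) t₀ := (hu t₀).fun_sub ((hu (σ t₀)).comp hσa)
  have hleft : ∀ᶠ p : ℝ × ℝ in 𝓝 (t₀, s₀), ψ (y p.2) = p.2 :=
    (continuousAt_snd (p := (t₀, s₀))).eventually hψl
  have hsep' : S₁ t₀ - S₁ (σ t₀) = 0 → S₂ t₀ - S₂ (σ t₀) ≠ 0 := by
    rw [hσ0, sub_eq_zero, sub_ne_zero]; exact hsep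
  rcases huσ.eventually_eq_zero_or_eventually_ne_zero with h | h
  -- If u = u ∘ σ near t₀, the β-terms cancel in the derivative of the z-difference, leaving -y'
  -- times the x-difference. A double point is then a double zero.
  · obtain ⟨W, hW, hWg⟩ := exists_nhds_generic_no_double_zero (hcomp hz) (hcomp hS₁) (hcomp hS₂)
      hsep'
    have hW' : ∀ᶠ t in 𝓝 t₀, t ∈ W ∧ (∀ᶠ r in 𝓝 t, u r - u (σ r) = 0) ∧
        (∀ᶠ r in 𝓝 t, y (σ r) = y r) ∧ AnalyticAt ℝ σ t :=
      Eventually.and hW (h.eventually_nhds.and (hyσ.eventually_nhds.and hσa.eventually_analyticAt))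
    refine ⟨_, hleft.and ((continuousAt_fst (p := (t₀, s₀))).eventually hW'), hWg.mono ?_⟩
    rintro a b hab ⟨t, s⟩ ⟨hs, htW, hut, hyt, hσt⟩ ey - ex ez
    have hst : s = σ t := hs.symm.trans (congrArg ψ ey.symm)
    simp only at ex ez
    rw [hst] at ex ez
    refine hab t htW (by linarith) ?_
    have dσ := hσt.differentiableAt.hasDerivAt
    have dcomp : ∀ {f : ℝ → ℝ}, (∀ t, AnalyticAt ℝ f t) →
        deriv (fun t ↦ f t - f (σ t)) t = deriv f t - deriv f (σ t) * deriv σ t := fun {f} hf ↦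
      ((hf t).differentiableAt.hasDerivAt.fun_sub
        ((hf (σ t)).differentiableAt.hasDerivAt.comp t dσ)).deriv
    have dy : deriv y (σ t) * deriv σ t = deriv y t := by
      rw [← ((hy (σ t)).differentiableAt.hasDerivAt.comp t dσ).deriv]
      exact EventuallyEq.deriv_eq hyt
    have du : deriv u t = deriv σ t • deriv u (σ t) := by
      rw [← ((hu (σ t)).differentiableAt.hasDerivAt.scomp t dσ).deriv]
      exact EventuallyEq.deriv_eq (hut.mono fun r hr ↦ sub_eq_zero.1 hr)
    have hu0 : u t = u (σ t) := sub_eq_zero.1 hut.self_of_nhds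
    rw [dcomp hz, dcomp hS₁, dcomp hS₂]
    simp only [hz', hS₁', hS₂', hu0, du, map_smul, smul_eq_mul]
    linear_combination (-deriv y t) * ex +
      (x (σ t) + a * R₁ (σ t) + b * R₂ (σ t)) * dy
  -- Otherwise u = u ∘ σ only at t₀ locally, and one linear condition on (a, b) suffices.
  · rw [eventually_nhdsWithin_iff] at h
    refine ⟨_, hleft.and ((continuousAt_fst (p := (t₀, s₀))).eventually h),
      (Generic.line (c := z t₀ - z (σ t₀)) hsep').mono ?_⟩
    rintro a b hab ⟨t, s⟩ ⟨hs, ht⟩ ey eu - ez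
    have hst : s = σ t := hs.symm.trans (congrArg ψ ey.symm)
    simp only at ez eu
    rw [hst] at ez eu
    have htt : t = t₀ := by
      by_contra hne
      exact ht hne (sub_eq_zero.2 eu)
    rw [htt] at ez
    exact hab (by linarith)

/-- Pairs with regular second point are covered by countably many of the preceding neighbourhoods.
Pairs with critical second point are countable, because critical points and level sets of y are, and
each is excluded by separating the z-values. -/
theorem generic_injective {x y z S₁ S₂ R₁ R₂ : ℝ → ℝ} {u : ℝ → V} {β : V → V →L[ℝ] ℝ}
    (hy : ∀ t, AnalyticAt ℝ y t) (hz : ∀ t, AnalyticAt ℝ z t) (hu : ∀ t, AnalyticAt ℝ u t)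
    (hS₁ : ∀ t, AnalyticAt ℝ S₁ t) (hS₂ : ∀ t, AnalyticAt ℝ S₂ t)
    (hz' : ∀ t, deriv z t = -x t * deriv y t - β (u t) (deriv u t))
    (hS₁' : ∀ t, deriv S₁ t = -R₁ t * deriv y t) (hS₂' : ∀ t, deriv S₂ t = -R₂ t * deriv y t)
    (hsep : ∀ s t, S₁ s = S₁ t → S₂ s = S₂ t → s = t)
    (hcrit : ∀ t, deriv y t = 0 → deriv (deriv y) t ≠ 0)
    (hR : ∀ t, deriv y t = 0 → deriv R₁ t = 0 → deriv R₂ t ≠ 0) :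
    Generic fun a b ↦ (∀ s t, y s = y t → u s = u t →
      x s + a * R₁ s + b * R₂ s = x t + a * R₁ t + b * R₂ t →
      z s + a * S₁ s + b * S₂ s = z t + a * S₁ t + b * S₂ t → s = t) ∧
      ∀ t, deriv y t = 0 → deriv x t + a * deriv R₁ t + b * deriv R₂ t ≠ 0 := by
  have hsep' : ∀ {t s}, t ≠ s → S₁ t = S₁ s → S₂ t ≠ S₂ s := fun hne e1 e2 ↦
    hne (hsep _ _ e1 e2)
  have hncrit : ∀ t, ¬∀ᶠ s in 𝓝 t, deriv y s = 0 := fun t h ↦ by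
    refine hcrit t h.self_of_nhds ?_
    rw [EventuallyEq.deriv_eq (f := fun _ ↦ 0) h, deriv_const]
  have hcritc : {t | deriv y t = 0}.Countable :=
    countable_zeros_of_analyticAt (fun t ↦ (hy t).deriv) hncrit
  have hlevel : ∀ c, {t | y t = c}.Countable := fun c ↦ by
    refine (countable_zeros_of_analyticAt (f := fun t ↦ y t - c)
      (fun t ↦ (hy t).fun_sub analyticAt_const) fun t h ↦ hncrit t ?_).mono fun t ht ↦
        sub_eq_zero.2 ht
    filter_upwards [h.eventually_nhds] with s hs
    have : y =ᶠ[𝓝 s] fun _ ↦ c := hs.mono fun r hr ↦ sub_eq_zero.1 hr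
    rw [this.deriv_eq, deriv_const]
  set G : Set (ℝ × ℝ) := {p | p.1 ≠ p.2 ∧ y p.1 = y p.2 ∧ deriv y p.2 ≠ 0}
  set K : Set (ℝ × ℝ) := {p | p.1 ≠ p.2 ∧ y p.1 = y p.2 ∧ deriv y p.2 = 0}
  have hK : K.Countable := by
    refine (hcritc.biUnion fun t _ ↦
      (hlevel (y t)).prod (Set.countable_singleton t)).mono ?_
    rintro ⟨t, s⟩ ⟨-, e, h⟩
    exact Set.mem_biUnion h ⟨e, rfl⟩
  have hGgen := (HereditarilyLindelofSpace.isLindelof G).induction_on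
    (p := fun T ↦ Generic fun a b ↦ ∀ p ∈ T, y p.1 = y p.2 → u p.1 = u p.2 →
      x p.1 + a * R₁ p.1 + b * R₂ p.1 = x p.2 + a * R₁ p.2 + b * R₂ p.2 →
      z p.1 + a * S₁ p.1 + b * S₂ p.1 ≠ z p.2 + a * S₁ p.2 + b * S₂ p.2)
    (fun s t hst h ↦ h.mono fun a b hab p hp ↦ hab p (hst hp))
    (fun S hS h ↦ (Generic.ball_countable hS h).mono fun a b hab p ⟨T, hT, hp⟩ ↦ hab T hT p hp)
    (fun p hp ↦ by
      obtain ⟨N, hN, hgen⟩ := exists_nhds_generic_ne (x := x) (R₁ := R₁) (R₂ := R₂) (β := β)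
        (t₀ := p.1) (s₀ := p.2) hy hz hu hS₁ hS₂ hz' hS₁' hS₂' (hsep' hp.1) hp.2.1 hp.2.2
      exact ⟨N, mem_nhdsWithin_of_mem_nhds hN, hgen⟩)
  have hKgen := Generic.ball_countable hK fun p hp ↦
    Generic.line (c := z p.1 - z p.2) (p := S₁ p.1 - S₁ p.2) (q := S₂ p.1 - S₂ p.2) fun h ↦
      sub_ne_zero.2 (hsep' hp.1 (sub_eq_zero.1 h))
  have himm := Generic.ball_countable hcritc fun t ht ↦
    Generic.line (c := deriv x t) (hR t ht)
  refine ((hGgen.and hKgen).and himm).mono fun a b hab ↦ ⟨fun s t ey eu ex ez ↦ ?_, hab.2⟩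
  by_contra hne
  by_cases hc : deriv y t = 0
  · exact hab.1.2 (s, t) ⟨hne, ey, hc⟩ (by linear_combination ez)
  · exact hab.1.1 (s, t) ⟨hne, ey, hc⟩ ey eu ex ez

end Legendrian

/-! ### Assembly in arbitrary dimension -/

section Coordinates

variable {ι : Type*} [Fintype ι]

theorem EuclideanSpace.analyticAt_toLp {c : ι → ℝ → ℝ} {t : ℝ} (hc : ∀ i, AnalyticAt ℝ (c i) t) :
    AnalyticAt ℝ (fun t ↦ WithLp.toLp 2 fun i ↦ c i t : ℝ → EuclideanSpace ℝ ι) t :=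
  ((PiLp.continuousLinearEquiv 2 ℝ fun _ : ι ↦ ℝ).symm.toContinuousLinearMap.analyticAt _).comp
    (AnalyticAt.pi hc)

theorem EuclideanSpace.deriv_toLp {c : ι → ℝ → ℝ} {t : ℝ}
    (hc : ∀ i, DifferentiableAt ℝ (c i) t) :
    deriv (fun t ↦ WithLp.toLp 2 fun i ↦ c i t : ℝ → EuclideanSpace ℝ ι) t =
      WithLp.toLp 2 fun i ↦ deriv (c i) t :=
  ((PiLp.continuousLinearEquiv 2 ℝ fun _ : ι ↦ ℝ).symm.toContinuousLinearMap.hasFDerivAt.comp_hasDerivAt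
    t (hasDerivAt_pi.2 fun i ↦ (hc i).hasDerivAt)).deriv

theorem EuclideanSpace.norm_lt_of_forall_abs_lt [Nonempty ι] {v : EuclideanSpace ℝ ι} {r : ℝ}
    (h : ∀ i, |v i| < r / Fintype.card ι) : ‖v‖ < r := by
  have hN : (1 : ℝ) ≤ Fintype.card ι := by exact_mod_cast Fintype.card_pos
  have hr : 0 < r := by
    have h1 := (abs_nonneg _).trans_lt (h (Classical.arbitrary ι))
    by_contra! hr
    exact absurd h1 (not_lt.2 (div_nonpos_of_nonpos_of_nonneg hr (by linarith)))
  refine lt_of_pow_lt_pow_left₀ 2 hr.le ?_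
  rw [EuclideanSpace.norm_sq_eq]
  calc ∑ i, ‖v i‖ ^ 2 < ∑ _i : ι, (r / Fintype.card ι) ^ 2 :=
        Finset.sum_lt_sum_of_nonempty Finset.univ_nonempty fun i _ ↦
          pow_lt_pow_left₀ (h i) (abs_nonneg _) two_ne_zero
    _ = r ^ 2 / Fintype.card ι := by
        rw [Finset.sum_const, Finset.card_univ, nsmul_eq_mul]; field_simp
    _ ≤ r ^ 2 := div_le_self (sq_nonneg r) hN

end Coordinates

namespace ContactSpace

theorem contactForm_apply {m : ℕ} (p v : ContactSpace m) :
    contactForm p v = v zIdx + ∑ i, p (xIdx i) * v (yIdx i) := by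
  simp [contactForm]

theorem exists_injective_legendrian_approx {m : ℕ} (i₀ : Fin m) (f₀ : C(ℝ, ContactSpace m))
    {ε : ℝ → ℝ} (hε : Continuous ε) (hε0 : ∀ t, 0 < ε t) :
    ∃ f ∈ fineNhd f₀ ε, AnalyticOnNhd ℝ f Set.univ ∧ Function.Injective f ∧
      IsLegendrianImmersion f := by
  -- The budget is 4δ per coordinate: δ for Carleman approximation, δ for the Legendrian step, 2δ
  -- for the perturbation with a, b < 1.
  set δ : ℝ → ℝ := fun t ↦ ε t / Fintype.card (Fin m ⊕ Fin m ⊕ Unit) / 4 with hδ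
  have hcard : (0 : ℝ) < Fintype.card (Fin m ⊕ Fin m ⊕ Unit) := by exact_mod_cast Fintype.card_pos
  have hδc : Continuous δ := (hε.div_const _).div_const _
  have hδ0 : ∀ t, 0 < δ t := fun t ↦ div_pos (div_pos (hε0 t) hcard) four_pos
  have hf₀ : ∀ j, Continuous fun t ↦ f₀ t j := fun j ↦ by fun_prop
  choose X hX hXδ using fun i : Fin m ↦ exists_analytic_approx (hf₀ (xIdx i)) hδc hδ0
  choose Y hY hYδ using fun i : Fin m ↦ exists_analytic_approx (hf₀ (yIdx i)) hδc hδ0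
  obtain ⟨W, hW, hW'⟩ := exists_analytic_primitive
    (f := fun t ↦ ∑ i : {i // i ≠ i₀}, X i t * deriv (Y i) t)
    fun t ↦ Finset.univ.analyticAt_fun_sum fun i _ ↦ (hX i t).fun_mul (hY i t).deriv
  have hWc : Continuous W := continuous_iff_continuousAt.2 fun t ↦ (hW t).continuousAt
  -- The target is shifted by W because the final z-coordinate is z - W plus the perturbation.
  obtain ⟨Z, hZ, hZδ⟩ := exists_analytic_approx ((hf₀ zIdx).fun_add hWc) hδc hδ0
  obtain ⟨x, y, z, ⟨hx, hy, hz⟩, ⟨hxX, hyY, hzZ⟩, hz', hcrit⟩ :=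
    exists_legendrian_approx (hX i₀) (hY i₀) hZ hδc hδ0
  obtain ⟨S₁, S₂, R₁, R₂, ⟨hS₁, hS₂, hR₁, hR₂⟩, ⟨hS₁', hS₂'⟩, ⟨bS₁, bS₂, bR₁, bR₂⟩, hsep, hR⟩ :=
    exists_separating_perturbations hy hcrit hδc hδ0
  let u : ℝ → ({i // i ≠ i₀} → ℝ) × ({i // i ≠ i₀} → ℝ) := fun t ↦ (fun i ↦ X i t, fun i ↦ Y i t)
  let β : ({i // i ≠ i₀} → ℝ) × ({i // i ≠ i₀} → ℝ) →
      ({i // i ≠ i₀} → ℝ) × ({i // i ≠ i₀} → ℝ) →L[ℝ] ℝ := fun p ↦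
    ∑ i, p.1 i • (ContinuousLinearMap.proj i ∘L ContinuousLinearMap.snd ℝ _ _)
  have hu : ∀ t, AnalyticAt ℝ u t := fun t ↦
    (AnalyticAt.pi fun i : {i // i ≠ i₀} ↦ hX i t).prod
      (AnalyticAt.pi fun i : {i // i ≠ i₀} ↦ hY i t)
  have hu' : ∀ t, deriv u t =
      (fun i : {i // i ≠ i₀} ↦ deriv (X i) t, fun i : {i // i ≠ i₀} ↦ deriv (Y i) t) := fun t ↦
    ((hasDerivAt_pi.2 fun i : {i // i ≠ i₀} ↦ (hX i t).differentiableAt.hasDerivAt).prodMk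
      (hasDerivAt_pi.2 fun i : {i // i ≠ i₀} ↦ (hY i t).differentiableAt.hasDerivAt)).deriv
  have hβ : ∀ t, β (u t) (deriv u t) = ∑ i : {i // i ≠ i₀}, X i t * deriv (Y i) t := fun t ↦ by
    rw [hu']
    simp [β, u]
  obtain ⟨a, ha, b, hb, hinj, himm⟩ := (generic_injective (z := fun t ↦ z t - W t) (x := x)
    (R₁ := R₁) (R₂ := R₂) (β := β) hy (fun t ↦ (hz t).fun_sub (hW t)) hu hS₁ hS₂
    (fun t ↦ by
      rw [((hz t).differentiableAt.hasDerivAt.fun_sub (hW' t)).deriv, hz', hβ])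
    hS₁' hS₂' hsep hcrit hR).exists_mem_Ioo one_pos
  have hpert : ∀ {S T : ℝ → ℝ} {t}, |S t| ≤ δ t → |T t| ≤ δ t →
      |a * S t + b * T t| ≤ 2 * δ t := fun {S T t} hS hT ↦ by
    refine (abs_add_le _ _).trans ?_
    rw [abs_mul, abs_mul, abs_of_pos ha.1, abs_of_pos hb.1]
    have h1 := mul_le_of_le_one_left (abs_nonneg (S t)) ha.2.le
    have h2 := mul_le_of_le_one_left (abs_nonneg (T t)) hb.2.le
    linarith
  let xs : Fin m → ℝ → ℝ := Function.update X i₀ fun t ↦ x t + a * R₁ t + b * R₂ t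
  let ys : Fin m → ℝ → ℝ := Function.update Y i₀ y
  let c : Fin m ⊕ Fin m ⊕ Unit → ℝ → ℝ := Sum.elim xs
    (Sum.elim ys fun _ t ↦ z t - W t + a * S₁ t + b * S₂ t)
  have hxs₀ : xs i₀ = fun t ↦ x t + a * R₁ t + b * R₂ t := Function.update_self ..
  have hys₀ : ys i₀ = y := Function.update_self ..
  have hxs : ∀ {i}, i ≠ i₀ → xs i = X i := fun h ↦ Function.update_of_ne h ..
  have hys : ∀ {i}, i ≠ i₀ → ys i = Y i := fun h ↦ Function.update_of_ne h ..
  have hc : ∀ j t, AnalyticAt ℝ (c j) t := by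
    rintro (i | i | i) t
    · rcases eq_or_ne i i₀ with rfl | h
      · change AnalyticAt ℝ (xs i) t
        rw [hxs₀]
        exact ((hx t).fun_add (analyticAt_const.fun_mul (hR₁ t))).fun_add
          (analyticAt_const.fun_mul (hR₂ t))
      · change AnalyticAt ℝ (xs i) t
        rw [hxs h]
        exact hX i t
    · rcases eq_or_ne i i₀ with rfl | h
      · change AnalyticAt ℝ (ys i) t
        rw [hys₀]
        exact hy t
      · change AnalyticAt ℝ (ys i) t
        rw [hys h]
        exact hY i t
    · exact (((hz t).fun_sub (hW t)).fun_add (analyticAt_const.fun_mul (hS₁ t))).fun_add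
        (analyticAt_const.fun_mul (hS₂ t))
  let f : ℝ → ContactSpace m := fun t ↦ WithLp.toLp 2 fun j ↦ c j t
  have hfa : ∀ t, AnalyticAt ℝ f t := fun t ↦ EuclideanSpace.analyticAt_toLp fun j ↦ hc j t
  have hfd : ∀ t, deriv f t = WithLp.toLp 2 fun j ↦ deriv (c j) t := fun t ↦
    EuclideanSpace.deriv_toLp fun j ↦ (hc j t).differentiableAt
  have hzd : ∀ t, deriv (c zIdx) t = -(x t + a * R₁ t + b * R₂ t) * deriv y t -
      ∑ i : {i // i ≠ i₀}, X i t * deriv (Y i) t := fun t ↦ by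
    have h1 := (((hz t).differentiableAt.hasDerivAt.fun_sub (hW' t)).fun_add
      ((hS₁ t).differentiableAt.hasDerivAt.const_mul a)).fun_add
      ((hS₂ t).differentiableAt.hasDerivAt.const_mul b)
    change deriv (fun t ↦ z t - W t + a * S₁ t + b * S₂ t) t = _
    rw [h1.deriv, hz', hS₁', hS₂']
    ring
  refine ⟨⟨f, continuous_iff_continuousAt.2 fun t ↦ (hfa t).continuousAt⟩, fun t ↦ ?_,
    fun t _ ↦ hfa t, fun s t hst ↦ ?_,
    ⟨contDiff_iff_contDiffAt.2 fun t ↦ (hfa t).contDiffAt, fun t h0 ↦ ?_, fun t ↦ ?_⟩⟩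
  · refine EuclideanSpace.norm_lt_of_forall_abs_lt fun j ↦ ?_
    have hδε : ε t / Fintype.card (Fin m ⊕ Fin m ⊕ Unit) = 4 * δ t := by simp only [hδ]; ring
    rw [hδε]
    change |c j t - f₀ t j| < _
    have hδt := hδ0 t
    rcases j with i | i | i
    · change |xs i t - f₀ t (xIdx i)| < _
      have h1 := abs_lt.1 (hXδ i t)
      rcases eq_or_ne i i₀ with rfl | h
      · rw [hxs₀]
        have h2 := abs_lt.1 (hxX t)
        have h3 := abs_le.1 (hpert (bR₁ t) (bR₂ t))
        rw [abs_lt]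
        constructor <;> linarith
      · rw [hxs h, abs_lt]
        constructor <;> linarith
    · change |ys i t - f₀ t (yIdx i)| < _
      have h1 := abs_lt.1 (hYδ i t)
      rcases eq_or_ne i i₀ with rfl | h
      · rw [hys₀]
        have h2 := abs_lt.1 (hyY t)
        rw [abs_lt]
        constructor <;> linarith
      · rw [hys h, abs_lt]
        constructor <;> linarith
    · change |z t - W t + a * S₁ t + b * S₂ t - f₀ t zIdx| < _
      have h1 := abs_lt.1 (hZδ t)
      have h2 := abs_lt.1 (hzZ t)
      have h3 := abs_le.1 (hpert (bS₁ t) (bS₂ t))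
      rw [abs_lt]
      constructor <;> linarith
  · have hcst : ∀ j, c j s = c j t := fun j ↦ congrArg (fun v : ContactSpace m ↦ v j) hst
    refine hinj s t ?_ ?_ ?_ (hcst zIdx)
    · simpa only [c, Sum.elim_inl, Sum.elim_inr, hys₀] using hcst (yIdx i₀)
    · refine Prod.ext (funext fun i ↦ ?_) (funext fun i ↦ ?_)
      · simpa only [c, Sum.elim_inl, Sum.elim_inr, hxs i.2] using hcst (xIdx i)
      · simpa only [c, Sum.elim_inl, Sum.elim_inr, hys i.2] using hcst (yIdx i)
    · simpa only [c, Sum.elim_inl, Sum.elim_inr, hxs₀] using hcst (xIdx i₀)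
  · have hcd : ∀ j, deriv (c j) t = 0 := fun j ↦ by
      have := congrArg (fun v : ContactSpace m ↦ v j) ((hfd t).symm.trans h0)
      exact this
    have hy0 : deriv y t = 0 := by
      simpa only [c, Sum.elim_inl, Sum.elim_inr, hys₀] using hcd (yIdx i₀)
    refine himm t hy0 ?_
    have h1 := ((hx t).differentiableAt.hasDerivAt.fun_add
      ((hR₁ t).differentiableAt.hasDerivAt.const_mul a)).fun_add
      ((hR₂ t).differentiableAt.hasDerivAt.const_mul b)
    have h2 := hcd (xIdx i₀)
    simp only [c, Sum.elim_inl, hxs₀] at h2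
    rw [← h1.deriv, h2]
  · change contactForm (f t) (deriv f t) = 0
    rw [contactForm_apply, hfd]
    change deriv (c zIdx) t + ∑ i, xs i t * deriv (ys i) t = 0
    rw [Fintype.sum_eq_add_sum_subtype_ne _ i₀, hxs₀, hys₀, hzd]
    have h1 : ∀ i : {i // i ≠ i₀}, xs i t * deriv (ys i) t = X i t * deriv (Y i) t := fun i ↦ by
      rw [hxs i.2, hys i.2]
    rw [Finset.sum_congr rfl fun i _ ↦ h1 i]
    ring

end ContactSpace

theorem theorem1p3 (n : ℕ) (hn : 1 < n) (f₀ : C(ℝ, ContactSpace (n - 1)))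
    (ε : ℝ → ℝ) (hε : Continuous ε) (hε_pos : ∀ t, 0 < ε t) :
    ∃ f ∈ fineNhd f₀ ε,
      AnalyticOnNhd ℝ f Set.univ ∧ Function.Injective f ∧
        ContactSpace.IsLegendrianImmersion f :=
  ContactSpace.exists_injective_legendrian_approx ⟨0, Nat.sub_pos_of_lt hn⟩ f₀ hε hε_pos
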